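/- Let $n\ge 1$, let $k_1,\dots,k_n\ge 0$ be integers and let $A_{ij}\in\mathbb R^{k_i\times k_j}$ for $1\le i,j\le n$. Each dimension $i$ is either continuous, with independent variable $j_i\in\mathbb T_i=\mathbb R$ and $\mathbf q_i=\partial/\partial j_i$, or discrete, with $j_i\in\mathbb T_i=\mathbb Z$ and $\mathbf q_i$ the unit forward shift in $j_i$. Consider the $n$D Roesser model $$\mathbf q_i x_i=\sum_{j=1}^n A_{ij}x_j,\qquad i=1,\dots,n,$$ whose first dimension is the time. *Trajectories and stability.* Let $L$ be the set of signals on $\mathbb T_2\times\dots\times\mathbb T_n$ with finite mixed $L_2$/$\ell_2$ norm $\|\cdot\|_2$, i.e. the squared Euclidean length is integrated over the continuous variables (Lebesgue measure) and summed over the discrete ones. A trajectory consists of $x_i(j_1)\in L$ with values in $\mathbb R^{k_i}$, for $i=1,\dots,n$, which satisfy the equations at all times $j_1\ge 0$; derivatives, in time and in space, are limits of difference quotients with respect to $\|\cdot\|_2$ (one-sided in time at $j_1=0$). The model is *time-relevant stable in the sense of $\|\cdot\|_2$* if it is uniformly asymptotically stable along dimension 1, i.e. (a) for every $\varepsilon>0$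 there is $\eta>0$ such that every trajectory with $\|x_1(0)\|_2\le\eta$ satisfies $\|x_1(j_1)\|_2\le\varepsilon$ for all $j_1\ge0$; and (b) there is $\eta>0$ such that for every $\varepsilon>0$ there is $T\ge0$ such that every trajectory with $\|x_1(0)\|_2\le\eta$ satisfies $\|x_1(j_1)\|_2\le\varepsilon$ for all $j_1\ge T$. *The matrix $M(\delta)$.* Let $R_i=\begin{pmatrix}r_{i_{11}}&r_{i_{10}}\\ r_{i_{10}}&r_{i_{00}}\end{pmatrix}$ be $\begin{pmatrix}0&1\\1&0\end{pmatrix}$ if dimension $i$ is continuous and $\begin{pmatrix}1&0\\0&-1\end{pmatrix}$ if it is discrete, so that $\partial\mathcal D_i\subset\mathbb C\cup\{\infty\}$ is the extended imaginary axis $\mathrm i\mathbb R\cup\{\infty\}$, respectively the unit circle. For $\delta=(\delta_i)_{i=2}^n\in\partial\mathcal D_2\times\dots\times\partial\mathcal D_n$ put $$M(\delta)=A_{11}+C\,(I-\Delta A)^{-1}\Delta B,\qquad \Delta=\delta_2I_{k_2}\oplus\dots\oplus\delta_nI_{k_n},$$ where $A=(A_{ij})_{i,j\ge2}$, $B=(A_{i1})_{i\ge2}$,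 $C=(A_{1j})_{j\ge2}$. At infinite $\delta_i$ the formula is read in homogeneous coordinates: in the $i$-th block row of $(I-\Delta A)^{-1}\Delta B$, the matrices $I-\Delta A$ and $\Delta B$ are first divided by $\delta_i$. Assume that $M(\delta)$ is well defined, i.e. that the matrix to be inverted is nonsingular, for every $\delta\in\partial\mathcal D_2\times\dots\times\partial\mathcal D_n$. **Theorem.** Under this assumption the model is time-relevant stable in the sense of $\|\cdot\|_2$ if and only if for every $\delta\in\partial\mathcal D_2\times\dots\times\partial\mathcal D_n$ there is a positive definite Hermitian matrix $P(\delta)\in\mathbb C^{k_1\times k_1}$ with $$r_{1_{00}}P(\delta)+r_{1_{10}}M(\delta)^*P(\delta)+r_{1_{10}}P(\delta)M(\delta)+r_{1_{11}}M(\delta)^*P(\delta)M(\delta)<0 .$$ -/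

import Mathlib

open MeasureTheory Matrix
open scoped ComplexOrder

noncomputable section

namespace Roesser

/-- How information propagates along a dimension: `q` is the partial derivative (continuous
dimension) or the unit forward shift (discrete dimension). -/
inductive Propagation where
  | derivative
  | shift

/-! ### Stability regions and their boundaries in the extended complex plane -/

/-- The matrix `R` with entries `r₁₁ r₁₀ ; r₁₀ r₀₀` (row and column `0` carry the index `1`, row and
column `1` the index `0`): it describes the open left half plane for a derivative and the open unit
disc for a shift. -/
def regionMatrix : Propagation → Matrix (Fin 2) (Fin 2) ℝ
  | .derivative => !![0, 1; 1, 0]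
  | .shift => !![1, 0; 0, -1]

/-- `R̂`: the two diagonal entries of `R` are exchanged. -/
def regionMatrixHat (q : Propagation) : Matrix (Fin 2) (Fin 2) ℝ :=
  !![regionMatrix q 1 1, regionMatrix q 0 1; regionMatrix q 1 0, regionMatrix q 0 0]

/-- First homogeneous coordinate: `δ = [δ : 1]` for finite `δ`, and `∞ = [1 : 0]`. -/
def num : OnePoint ℂ → ℂ
  | OnePoint.some z => z
  | OnePoint.infty => 1

/-- Second homogeneous coordinate: `δ = [δ : 1]` for finite `δ`, and `∞ = [1 : 0]`. -/
def den : OnePoint ℂ → ℂ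
  | OnePoint.some _ => 1
  | OnePoint.infty => 0

/-- The form `f(R, δ) = (δ, 1)' R (δ, 1)` (`'` is the conjugate transpose), evaluated on the
homogeneous coordinates of `δ`, so that it also makes sense at `∞`. -/
def regionForm (R : Matrix (Fin 2) (Fin 2) ℝ) (δ : OnePoint ℂ) : ℂ :=
  star ![num δ, den δ] ⬝ᵥ (R.map Complex.ofReal *ᵥ ![num δ, den δ])

/-- The boundary `∂D = {δ : f(R, δ) = f(R̂, δ) = 0}` in the extended complex plane. -/
def regionBoundary (q : Propagation) : Set (OnePoint ℂ) :=
  {δ | regionForm (regionMatrix q) δ = 0 ∧ regionForm (regionMatrixHat q) δ = 0}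

/-- The boundary for a derivative is the extended imaginary axis. -/
theorem mem_regionBoundary_derivative (δ : OnePoint ℂ) :
    δ ∈ regionBoundary .derivative ↔ δ = OnePoint.infty ∨ ∃ ω : ℝ, δ = ((ω * Complex.I : ℂ)) := by
  induction δ using OnePoint.rec with
  | infty =>
    simp [regionBoundary, regionForm, regionMatrix, regionMatrixHat, num, den, dotProduct,
      Matrix.mulVec, Fin.sum_univ_two]
  | coe z =>
    have h : regionForm (regionMatrix .derivative) (z : OnePoint ℂ) = ((2 * z.re : ℝ) : ℂ) := by
      change star ![z, 1] ⬝ᵥ _ *ᵥ ![z, 1] = _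
      apply Complex.ext <;>
      simp [regionMatrix, dotProduct, Matrix.mulVec, Fin.sum_univ_two] <;> ring
    have h2 : regionForm (regionMatrixHat .derivative) (z : OnePoint ℂ) =
        regionForm (regionMatrix .derivative) (z : OnePoint ℂ) := by
      simp [regionMatrix, regionMatrixHat]
    simp only [regionBoundary, Set.mem_ofPred_eq, h2, h, and_self, OnePoint.coe_ne_infty, false_or,
      OnePoint.coe_eq_coe]
    constructor
    · intro h
      refine ⟨z.im, ?_⟩
      have : z.re = 0 := by
        have := Complex.ofReal_eq_zero.1 h
        linarith
      apply Complex.ext <;> simp [this]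
    · rintro ⟨ω, rfl⟩
      simp

/-- The boundary for a shift is the unit circle. -/
theorem mem_regionBoundary_shift (δ : OnePoint ℂ) :
    δ ∈ regionBoundary .shift ↔ ∃ z : ℂ, ‖z‖ = 1 ∧ δ = (z : OnePoint ℂ) := by
  induction δ using OnePoint.rec with
  | infty =>
    simp [regionBoundary, regionForm, regionMatrix, regionMatrixHat, num, den, dotProduct,
      Matrix.mulVec, Fin.sum_univ_two]
  | coe z =>
    have h : regionForm (regionMatrix .shift) (z : OnePoint ℂ) = ((‖z‖ ^ 2 - 1 : ℝ) : ℂ) := by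
      change star ![z, 1] ⬝ᵥ _ *ᵥ ![z, 1] = _
      rw [← Complex.normSq_eq_norm_sq]
      apply Complex.ext <;>
      simp [regionMatrix, dotProduct, Matrix.mulVec, Fin.sum_univ_two, Complex.normSq_apply] <;>
      ring
    have h2 : regionForm (regionMatrixHat .shift) (z : OnePoint ℂ) =
        -((‖z‖ ^ 2 - 1 : ℝ) : ℂ) := by
      change star ![z, 1] ⬝ᵥ _ *ᵥ ![z, 1] = _
      rw [← Complex.normSq_eq_norm_sq]
      apply Complex.ext <;>
      simp [regionMatrix, regionMatrixHat, dotProduct, Matrix.mulVec, Fin.sum_univ_two,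
        Complex.normSq_apply] <;>
      ring
    simp only [regionBoundary, Set.mem_ofPred_eq, h2, h, neg_eq_zero, and_self, OnePoint.coe_eq_coe,
      Complex.ofReal_eq_zero]
    constructor
    · intro h
      refine ⟨z, ?_, rfl⟩
      nlinarith [norm_nonneg z]
    · rintro ⟨w, hw, rfl⟩
      simp [hw]

/-! ### The axes -/

/-- The values of the independent variable along a dimension: real for a derivative, integer for a
shift. -/
def Axis : Propagation → Type
  | .derivative => ℝ
  | .shift => ℤ

instance : ∀ q, AddCommGroup (Axis q)
  | .derivative => inferInstanceAs (AddCommGroup ℝ)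
  | .shift => inferInstanceAs (AddCommGroup ℤ)

instance : ∀ q, LinearOrder (Axis q)
  | .derivative => inferInstanceAs (LinearOrder ℝ)
  | .shift => inferInstanceAs (LinearOrder ℤ)

instance : ∀ q, MeasurableSpace (Axis q)
  | .derivative => inferInstanceAs (MeasurableSpace ℝ)
  | .shift => inferInstanceAs (MeasurableSpace ℤ)

instance : ∀ q, MeasurableAdd (Axis q)
  | .derivative => inferInstanceAs (MeasurableAdd ℝ)
  | .shift => inferInstanceAs (MeasurableAdd ℤ)

/-- Lebesgue measure on a continuous axis, counting measure on a discrete one. -/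
def axisMeasure : ∀ q, Measure (Axis q)
  | .derivative => (volume : Measure ℝ)
  | .shift => (Measure.count : Measure ℤ)

instance : ∀ q, SigmaFinite (axisMeasure q)
  | .derivative => inferInstanceAs (SigmaFinite (volume : Measure ℝ))
  | .shift => inferInstanceAs (SigmaFinite (Measure.count : Measure ℤ))

instance : ∀ q, (axisMeasure q).IsAddRightInvariant
  | .derivative => inferInstanceAs (volume : Measure ℝ).IsAddRightInvariant
  | .shift => inferInstanceAs (Measure.count : Measure ℤ).IsAddRightInvariant

/-- `(q w)(j) = v`, for a signal `w` on an axis with values in a normed space: `v` is the derivative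
of `w` at `j` within `s`, or the value of `w` at `j + 1`. -/
def AdvancesTo {E : Type*} [NormedAddCommGroup E] [NormedSpace ℝ E] :
    ∀ q, Set (Axis q) → (Axis q → E) → Axis q → E → Prop
  | .derivative => fun (s : Set ℝ) (w : ℝ → E) (j : ℝ) v => HasDerivWithinAt w v s j
  | .shift => fun (_ : Set ℤ) (w : ℤ → E) (j : ℤ) v => w (j + 1) = v

/-! ### Mixed `L²`-`ℓ²` signals on a product of axes -/

/-- The product of the axes. -/
abbrev Grid {m : ℕ} (q : Fin m → Propagation) : Type := ∀ i, Axis (q i)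

/-- The product of the Lebesgue and counting measures. -/
abbrev gridMeasure {m : ℕ} (q : Fin m → Propagation) : Measure (Grid q) :=
  Measure.pi fun i => axisMeasure (q i)

/-- Real vector signals on the grid with finite mixed `L²`-`ℓ²` norm: the squared Euclidean length is
integrated over the continuous axes and summed over the discrete ones. -/
abbrev Signal {m : ℕ} (q : Fin m → Propagation) (d : ℕ) : Type :=
  Lp (EuclideanSpace ℝ (Fin d)) 2 (gridMeasure q)

theorem measurePreserving_step {m : ℕ} (q : Fin m → Propagation) (i : Fin m) (h : Axis (q i)) :
    MeasurePreserving (fun j : Grid q => j + Pi.single i h) (gridMeasure q) (gridMeasure q) := by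
  refine measurePreserving_pi (fun i => axisMeasure (q i)) (fun i => axisMeasure (q i))
    (f := fun i' x => x + (Pi.single i h : Grid q) i') ?_
  intro i'
  exact measurePreserving_add_right _ _

/-- The translate `j ↦ x (j + h eᵢ)` of a signal along the axis `i`. -/
def translate {m : ℕ} {q : Fin m → Propagation} {d : ℕ} (i : Fin m) (x : Signal q d)
    (h : Axis (q i)) : Signal q d :=
  Lp.compMeasurePreserving (fun j : Grid q => j + Pi.single i h) (measurePreserving_step q i h) x

/-- A constant real matrix applied pointwise to a signal. -/
def matSignal {m : ℕ} {q : Fin m → Propagation} {d e : ℕ} (B : Matrix (Fin e) (Fin d) ℝ)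
    (x : Signal q d) : Signal q e :=
  (LinearMap.toContinuousLinearMap (Matrix.toEuclideanLin B)).compLp x

/-- `q_i x = y` along the axis `i` of the grid: `y` is the partial derivative of `x` (limit of the
difference quotients in the mixed norm), respectively the shifted signal. -/
def GridAdvancesTo {m : ℕ} {q : Fin m → Propagation} {d : ℕ} (i : Fin m) (x y : Signal q d) :
    Prop :=
  AdvancesTo (q i) Set.univ (translate i x) 0 y

/-! ### Models, trajectories and stability -/

/-- An `(m+1)`-dimensional Roesser model `q_i x_i = ∑ j, A_ij x_j` with `x_i` of size `k i`. Dimension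
`0` is the distinguished one (time); the others are `Fin.succ i`. -/
structure Model (m : ℕ) where
  q : Fin (m + 1) → Propagation
  k : Fin (m + 1) → ℕ
  A : ∀ i j, Matrix (Fin (k i)) (Fin (k j)) ℝ

variable {m : ℕ}

/-- The propagation types of the dimensions other than the first one. -/
abbrev Model.qs (S : Model m) : Fin m → Propagation := fun i => S.q i.succ

/-- State signals: at each instant along dimension `0`, each state subvector is a signal of finite
mixed norm in the other variables, which range over entire axes. -/
abbrev Model.StateSignal (S : Model m) : Type := ∀ i, Axis (S.q 0) → Signal S.qs (S.k i)

/-- The `i`-th block row of the right-hand side, at the instant `t`. -/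
def Model.rhs (S : Model m) (x : S.StateSignal) (i : Fin (m + 1)) (t : Axis (S.q 0)) :
    Signal S.qs (S.k i) :=
  ∑ j, matSignal (S.A i j) (x j t)

/-- `x` satisfies the equations of the model at all instants `t ≥ 0`. -/
structure Model.IsTrajectory (S : Model m) (x : S.StateSignal) : Prop where
  time : ∀ t, 0 ≤ t → AdvancesTo (S.q 0) (Set.Ici 0) (x 0) t (S.rhs x 0 t)
  space : ∀ t, 0 ≤ t → ∀ i : Fin m, GridAdvancesTo i (x i.succ t) (S.rhs x i.succ t)

/-- Time-relevant stability in the sense of the mixed `L²`-`ℓ²` norm: (uniform) asymptotic stability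
of the distinguished state subvector along dimension `0`, i.e. Lyapunov stability together with
convergence to zero that is uniform over a ball of initial data. -/
structure Model.TimeRelevantStable (S : Model m) : Prop where
  stable : ∀ ε : ℝ, 0 < ε → ∃ η : ℝ, 0 < η ∧ ∀ x : S.StateSignal, S.IsTrajectory x →
    ‖x 0 0‖ ≤ η → ∀ t, 0 ≤ t → ‖x 0 t‖ ≤ ε
  attractive : ∃ η : ℝ, 0 < η ∧ ∀ ε : ℝ, 0 < ε → ∃ T : Axis (S.q 0), 0 ≤ T ∧
    ∀ x : S.StateSignal, S.IsTrajectory x → ‖x 0 0‖ ≤ η → ∀ t, T ≤ t → ‖x 0 t‖ ≤ ε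

/-! ### The matrix `M(δ)` and the Stein/Lyapunov inequality -/

/-- Index of the stacked state subvectors of the dimensions other than the first one. -/
abbrev Model.Rest (S : Model m) : Type := Σ i : Fin m, Fin (S.k i.succ)

/-- `∂D_2 × ⋯ × ∂D_n`. -/
def Model.boundary (S : Model m) : Set (Fin m → OnePoint ℂ) :=
  {δ | ∀ i, δ i ∈ regionBoundary (S.qs i)}

/-- The blocks `A_ij` with `i, j ≥ 2`. -/
def Model.AM (S : Model m) : Matrix S.Rest S.Rest ℂ :=
  fun a b => (S.A a.1.succ b.1.succ a.2 b.2 : ℂ)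

/-- The blocks `A_i1` with `i ≥ 2`. -/
def Model.BM (S : Model m) : Matrix S.Rest (Fin (S.k 0)) ℂ :=
  fun a b => (S.A a.1.succ 0 a.2 b : ℂ)

/-- The blocks `A_1j` with `j ≥ 2`. -/
def Model.CM (S : Model m) : Matrix (Fin (S.k 0)) S.Rest ℂ :=
  fun a b => (S.A 0 b.1.succ a b.2 : ℂ)

/-- The block `A_11`. -/
def Model.DM (S : Model m) : Matrix (Fin (S.k 0)) (Fin (S.k 0)) ℂ :=
  fun a b => (S.A 0 0 a b : ℂ)

/-- `Δ = ⊕ δ_i I`: the numerators. -/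
def Model.numMat (S : Model m) (δ : Fin m → OnePoint ℂ) : Matrix S.Rest S.Rest ℂ :=
  Matrix.diagonal fun a => num (δ a.1)

/-- `Δ = ⊕ δ_i I`: the denominators; the identity matrix when all `δ i` are finite. -/
def Model.denMat (S : Model m) (δ : Fin m → OnePoint ℂ) : Matrix S.Rest S.Rest ℂ :=
  Matrix.diagonal fun a => den (δ a.1)

/-- The pencil `I - Δ A_M`, with the block rows of the infinite `δ i` scaled by `1 / δ i`. -/
def Model.pencil (S : Model m) (δ : Fin m → OnePoint ℂ) : Matrix S.Rest S.Rest ℂ :=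
  S.denMat δ - S.numMat δ * S.AM

/-- `M(δ)` is well defined for all `δ` in the product of the boundaries. -/
def Model.WellPosed (S : Model m) : Prop :=
  ∀ δ ∈ S.boundary, IsUnit (S.pencil δ).det

/-- `M(δ) = D_M + C_M (I - Δ A_M)⁻¹ Δ B_M`. -/
def Model.M (S : Model m) (δ : Fin m → OnePoint ℂ) : Matrix (Fin (S.k 0)) (Fin (S.k 0)) ℂ :=
  S.DM + S.CM * (S.pencil δ)⁻¹ * (S.numMat δ * S.BM)

/-- At finite `δ` this is the usual formula. -/
theorem Model.M_coe (S : Model m) (δ : Fin m → ℂ) :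
    S.M (fun i => (δ i : OnePoint ℂ)) =
      S.DM + S.CM * (1 - Matrix.diagonal (fun a : S.Rest => δ a.1) * S.AM)⁻¹ *
        (Matrix.diagonal (fun a : S.Rest => δ a.1) * S.BM) := by
  have h1 : S.denMat (fun i => (δ i : OnePoint ℂ)) = 1 := Matrix.diagonal_one
  have h2 : S.numMat (fun i => (δ i : OnePoint ℂ)) =
    Matrix.diagonal (fun a : S.Rest => δ a.1) := rfl
  rw [Model.M, Model.pencil, h1, h2]

/-- The left-hand side `r₀₀ P + r₁₀ M' P + r₁₀ P M + r₁₁ M' P M` of the Stein/Lyapunov inequality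
for the region attached to `q`. -/
def steinForm {d : ℕ} (q : Propagation) (M P : Matrix (Fin d) (Fin d) ℂ) :
    Matrix (Fin d) (Fin d) ℂ :=
  (regionMatrix q 1 1 : ℂ) • P + (regionMatrix q 0 1 : ℂ) • (Mᴴ * P) +
    (regionMatrix q 0 1 : ℂ) • (P * M) + (regionMatrix q 0 0 : ℂ) • (Mᴴ * P * M)

/-- `P` is a solution of the Stein/Lyapunov inequality at `δ`: `P > 0` and the form is `< 0`. -/
def Model.SolvesStein (S : Model m) (δ : Fin m → OnePoint ℂ)
    (P : Matrix (Fin (S.k 0)) (Fin (S.k 0)) ℂ) : Prop :=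
  P.PosDef ∧ (-(steinForm (S.q 0) (S.M δ) P)).PosDef

end Roesser

end

noncomputable section

namespace Roesser

open Filter Topology

section StabilityMatrices

/-! ### Powers, spectra and the Stein/Lyapunov inequality -/

/-! The idea is to treat the space equations as linear algebra over a commutative Banach algebra of
operators, with Gelfand theory in place of the Fourier transform. On complex scalar `L²`-`ℓ²`
signals each space axis acts by translations, and `exists_axisOperator` attaches to it an invertible
isometry `U i`. It is the backward shift for a discrete axis and the Cayley transform `(1 + D)(1 -
D)⁻¹` of the generator `D` for a continuous one. The equation `q x = y` then becomes `denOp U x =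
numOp U y` between bounded operators. The quotient `numOp / denOp` plays the role of `δ`, the
inverse of `q`, and `U` runs over the unit circle when `δ` runs over the boundary, infinity
included.

The `U i` and their inverses generate a closed commutative algebra, whose characters send each `U i`
to the unit circle. Well-posedness says that no character kills the determinant of the pencil, so
the pencil is invertible over the algebra (`WellPosed.isUnit_det_opPencil`). The space equations can
therefore be solved for the other subvectors, and the first one obeys `q x = N x` with the bounded
operator `N = M(U)` (`WellPosed.exists_operator`).

Sufficiency. A solution `P(δ)` confines the eigenvalues of `M(δ)` to the stability region. Every
spectral value of the unit-time step of `N` is, by a determinant and a character, an eigenvalue of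
the unit-time step of some `M(δ)`. Hence that spectrum lies in the open disc, the powers tend to
zero in norm by Gelfand's formula, and decay is uniform (`tendsto_norm_stepOp_pow`, `exists_decay`).
Compactness of the spectrum supplies the uniformity in `δ`, so `P` may depend on `δ` arbitrarily.

Necessity. Fix `δ` and an eigenpair `M(δ) v = z v`. Plane waves cut off to large boxes are
simultaneous approximate eigenvectors of all `U i` at the point of the torus that represents `δ`
(`exists_almost_eigenvector`). Approximate eigenvectors pass through sums, products and inverses, so
`v` times these waves are approximate eigenvectors of `N` for `z`. Stability shrinks them within a
fixed time, which forces `z` into the region (`TimeRelevantStable.inRegion`). The matrix inequality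
is then solved for each `δ` separately (`exists_steinForm`). -/

/-- Powers of an element whose spectrum lies in the open unit disc tend to zero. -/
theorem tendsto_norm_pow_of_spectrum {A : Type*} [NormedRing A] [NormedAlgebra ℂ A]
    [CompleteSpace A] (a : A) (ha : ∀ z ∈ spectrum ℂ a, ‖z‖ < 1) :
    Tendsto (fun n : ℕ => ‖a ^ n‖) atTop (𝓝 0) := by
  rcases subsingleton_or_nontrivial A with hA | hA
  · have : ∀ n : ℕ, ‖a ^ n‖ = 0 := fun n => by rw [Subsingleton.elim (a ^ n) 0, norm_zero]
    simp [this]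
  -- The spectrum is compact, so the pointwise bound stays strict for the spectral radius; this
  -- leaves room for a geometric ratio `r < 1`.
  have h1 : spectralRadius ℂ a < ((1 : NNReal) : ENNReal) :=
    spectrum.spectralRadius_lt_of_forall_lt a fun z hz => by
      have := ha z hz
      rwa [← NNReal.coe_lt_coe]
  obtain ⟨r, hr1, hr2⟩ := ENNReal.lt_iff_exists_nnreal_btwn.1 h1
  have hr2' : r < 1 := by exact_mod_cast hr2
  have hev := (spectrum.pow_nnnorm_pow_one_div_tendsto_nhds_spectralRadius a).eventually
    (gt_mem_nhds hr1)
  refine squeeze_zero' (Eventually.of_forall fun n => norm_nonneg _) ?_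
    (tendsto_pow_atTop_nhds_zero_of_lt_one r.2 (by exact_mod_cast hr2'))
  filter_upwards [hev, eventually_gt_atTop 0] with n hn hn0
  have hn0' : (n : ℝ) ≠ 0 := by positivity
  have h2 : ((‖a ^ n‖₊ : ENNReal) ^ (1 / (n : ℝ))) ^ (n : ℝ) ≤ (r : ENNReal) ^ (n : ℝ) :=
    ENNReal.rpow_le_rpow hn.le (by positivity)
  rw [← ENNReal.rpow_mul, one_div_mul_cancel hn0', ENNReal.rpow_one, ENNReal.rpow_natCast] at h2
  have h3 : ‖a ^ n‖₊ ≤ r ^ n := by exact_mod_cast h2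
  exact_mod_cast h3

theorem mem_spectrum_iff_exists_mulVec {d : ℕ} (M : Matrix (Fin d) (Fin d) ℂ) (z : ℂ) :
    z ∈ spectrum ℂ M ↔ ∃ v, v ≠ 0 ∧ M *ᵥ v = z • v := by
  rw [spectrum.mem_iff, Matrix.isUnit_iff_isUnit_det, isUnit_iff_ne_zero, not_not,
    ← Matrix.exists_mulVec_eq_zero_iff]
  refine exists_congr fun v => and_congr_right fun _ => ?_
  rw [Matrix.sub_mulVec, Algebra.algebraMap_eq_smul_one, Matrix.smul_mulVec, Matrix.one_mulVec,
    sub_eq_zero, eq_comm]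

/-- The open stability region in the complex plane: the left half plane for a derivative and the
unit disc for a shift. -/
def InRegion : Propagation → ℂ → Prop
  | .derivative => fun z => z.re < 0
  | .shift => fun z => ‖z‖ < 1

theorem posDef_of_re_pos {d : ℕ} {P : Matrix (Fin d) (Fin d) ℂ} (hP : P.IsHermitian)
    (h : ∀ v, v ≠ 0 → 0 < (star v ⬝ᵥ (P *ᵥ v)).re) : P.PosDef := by
  refine Matrix.PosDef.of_dotProduct_mulVec_pos hP fun v hv => ?_
  have him : (star v ⬝ᵥ (P *ᵥ v)).im = 0 := by
    have := hP.im_star_dotProduct_mulVec_self v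
    simpa using this
  exact Complex.lt_def.2 ⟨by simpa using h v hv, by simpa using him.symm⟩

theorem PosDef.re_pos {d : ℕ} {P : Matrix (Fin d) (Fin d) ℂ} (hP : P.PosDef) {v : Fin d → ℂ}
    (hv : v ≠ 0) : 0 < (star v ⬝ᵥ (P *ᵥ v)).re :=
  (Complex.lt_def.1 (hP.dotProduct_mulVec_pos hv)).1

theorem dotProduct_steinForm {d : ℕ} (q : Propagation) (M P : Matrix (Fin d) (Fin d) ℂ)
    (v : Fin d → ℂ) :
    star v ⬝ᵥ (steinForm q M P *ᵥ v) =
      (regionMatrix q 1 1 : ℂ) * (star v ⬝ᵥ (P *ᵥ v)) +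
      (regionMatrix q 0 1 : ℂ) * (star (M *ᵥ v) ⬝ᵥ (P *ᵥ v)) +
      (regionMatrix q 0 1 : ℂ) * (star v ⬝ᵥ (P *ᵥ (M *ᵥ v))) +
      (regionMatrix q 0 0 : ℂ) * (star (M *ᵥ v) ⬝ᵥ (P *ᵥ (M *ᵥ v))) := by
  simp only [steinForm, Matrix.add_mulVec, Matrix.smul_mulVec, dotProduct_add, dotProduct_smul,
    smul_eq_mul, ← Matrix.mulVec_mulVec, Matrix.star_mulVec, ← Matrix.dotProduct_mulVec]

/-- A solution of the Stein/Lyapunov inequality confines the eigenvalues to the region. -/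
theorem inRegion_of_steinForm {d : ℕ} {q : Propagation} {M P : Matrix (Fin d) (Fin d) ℂ}
    (hP : P.PosDef) (hS : (-(steinForm q M P)).PosDef) {z : ℂ} {v : Fin d → ℂ} (hv : v ≠ 0)
    (h : M *ᵥ v = z • v) : InRegion q z := by
  have h1 := PosDef.re_pos hP hv
  have h2 := PosDef.re_pos hS hv
  -- On an eigenvector the form is `v*Pv` times `2 Re z`, respectively `|z|² - 1`.
  rw [Matrix.neg_mulVec, dotProduct_neg, dotProduct_steinForm, h] at h2
  simp only [star_smul, Matrix.mulVec_smul, smul_dotProduct, dotProduct_smul, smul_eq_mul] at h2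
  set w := star v ⬝ᵥ (P *ᵥ v) with hw
  have him : w.im = 0 := by
    simpa using hP.isHermitian.im_star_dotProduct_mulVec_self v
  cases q with
  | derivative =>
    simp [regionMatrix, him] at h2
    change z.re < 0
    nlinarith
  | shift =>
    simp [regionMatrix, him] at h2
    have h3 : (z.re ^ 2 + z.im ^ 2) * w.re < w.re := by nlinarith
    have h4 : z.re ^ 2 + z.im ^ 2 < 1 := by
      by_contra h5
      nlinarith
    change ‖z‖ < 1
    rw [Complex.norm_eq_sqrt_sq_add_sq, Real.sqrt_lt' one_pos]
    linarith

open scoped Matrix.Norms.L2Operator in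
/-- Solvability of the Stein inequality for a matrix with eigenvalues in the open unit disc. -/
theorem exists_stein {d : ℕ} (M : Matrix (Fin d) (Fin d) ℂ)
    (h : ∀ (z : ℂ) (v : Fin d → ℂ), v ≠ 0 → M *ᵥ v = z • v → ‖z‖ < 1) :
    ∃ P : Matrix (Fin d) (Fin d) ℂ, P.PosDef ∧ (P - Mᴴ * P * M).PosDef := by
  have ht := tendsto_norm_pow_of_spectrum M fun z hz => by
    obtain ⟨v, hv, hMv⟩ := (mem_spectrum_iff_exists_mulVec M z).1 hz
    exact h z v hv hMv
  obtain ⟨N, hN, hN0⟩ := ((ht.eventually (gt_mem_nhds one_pos)).and (eventually_gt_atTop 0)).exists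
  -- A partial sum of the usual series suffices: the Stein difference telescopes to `1 - (M ^ N)ᴴ *
  -- M ^ N`, which is positive because `‖M ^ N‖ < 1`.
  let P := ∑ j ∈ Finset.range N, (M ^ j)ᴴ * M ^ j
  have hPP : P - Mᴴ * P * M = 1 - (M ^ N)ᴴ * M ^ N := by
    have : Mᴴ * P * M = ∑ j ∈ Finset.range N, (M ^ (j + 1))ᴴ * M ^ (j + 1) := by
      simp only [P, Finset.mul_sum, Finset.sum_mul]
      refine Finset.sum_congr rfl fun j _ => ?_
      rw [pow_succ, Matrix.conjTranspose_mul]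
      simp only [mul_assoc]
    rw [this, ← Finset.sum_sub_distrib,
      Finset.sum_range_sub' (fun j => (M ^ j)ᴴ * M ^ j) N]
    simp
  refine ⟨P, ?_, ?_⟩
  · obtain ⟨n, rfl⟩ := Nat.exists_eq_succ_of_ne_zero hN0.ne'
    simp only [P, Finset.sum_range_succ']
    refine Matrix.PosDef.posSemidef_add ?_ (by simpa using Matrix.PosDef.one)
    exact Matrix.posSemidef_sum _ fun j _ => Matrix.posSemidef_conjTranspose_mul_self _
  · rw [hPP]
    refine posDef_of_re_pos ?_ fun v hv => ?_
    · exact Matrix.isHermitian_one.sub (Matrix.isHermitian_conjTranspose_mul_self _)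
    · have key : ∀ x : Fin d → ℂ, (star x ⬝ᵥ x).re = ‖WithLp.toLp 2 x‖ ^ 2 := fun x => by
        rw [EuclideanSpace.norm_sq_eq]
        simp [dotProduct, Complex.sq_norm, Complex.normSq_apply]
      have hb := Matrix.l2_opNorm_mulVec (M ^ N) (WithLp.toLp 2 v)
      have hv0 : 0 < ‖WithLp.toLp 2 v‖ := norm_pos_iff.2 (by simpa using hv)
      rw [Matrix.sub_mulVec, Matrix.one_mulVec, dotProduct_sub, ← Matrix.mulVec_mulVec,
        Matrix.dotProduct_mulVec, ← Matrix.star_mulVec, Complex.sub_re, key, key]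
      have : ‖WithLp.toLp 2 (M ^ N *ᵥ v)‖ < ‖WithLp.toLp 2 v‖ :=
        lt_of_le_of_lt hb (by nlinarith)
      nlinarith [norm_nonneg (WithLp.toLp 2 (M ^ N *ᵥ v))]

/-- Solvability of the Lyapunov inequality, by the Cayley transformation. -/
theorem exists_lyapunov {d : ℕ} (M : Matrix (Fin d) (Fin d) ℂ)
    (h : ∀ (z : ℂ) (v : Fin d → ℂ), v ≠ 0 → M *ᵥ v = z • v → z.re < 0) :
    ∃ P : Matrix (Fin d) (Fin d) ℂ, P.PosDef ∧ (-(Mᴴ * P + P * M)).PosDef := by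
  have hu : IsUnit (1 - M).det := by
    rw [isUnit_iff_ne_zero]
    intro h0
    obtain ⟨v, hv, hMv⟩ := Matrix.exists_mulVec_eq_zero_iff.2 h0
    rw [Matrix.sub_mulVec, Matrix.one_mulVec, sub_eq_zero] at hMv
    have := h 1 v hv (by rw [one_smul, ← hMv])
    norm_num at this
  -- `W` is the Cayley transform of `M`. An eigenvalue `z` of `W` comes from the eigenvalue `(z - 1)
  -- / (1 + z)` of `M`, whose real part is negative exactly when `|z| < 1`.
  obtain ⟨W, hW1⟩ : ∃ W, W * (1 - M) = 1 + M :=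
    ⟨(1 + M) * (1 - M)⁻¹, by simp only [mul_assoc, Matrix.nonsing_inv_mul _ hu, mul_one]⟩
  obtain ⟨P, hP, hPW⟩ := exists_stein W fun z v hv hz => by
    set w := (1 - M)⁻¹ *ᵥ v with hw
    have hvw : v = (1 - M) *ᵥ w := by
      rw [hw, Matrix.mulVec_mulVec, Matrix.mul_nonsing_inv _ hu, Matrix.one_mulVec]
    have hw0 : w ≠ 0 := fun h0 => hv (by rw [hvw, h0, Matrix.mulVec_zero])
    rw [hvw, Matrix.mulVec_mulVec, hW1, Matrix.sub_mulVec, Matrix.add_mulVec,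
      Matrix.one_mulVec] at hz
    have h1 : (1 + z) • (M *ᵥ w) = (z - 1) • w := by
      rw [add_smul, sub_smul, one_smul, one_smul]
      rw [smul_sub] at hz
      linear_combination (exp := 1) hz
    have hz1 : 1 + z ≠ 0 := by
      intro h0
      rw [h0, zero_smul, eq_comm, smul_eq_zero, or_iff_left hw0] at h1
      have : (2 : ℂ) = 0 := by linear_combination h0 - h1
      norm_num at this
    have h2 := h ((z - 1) / (1 + z)) w hw0 (by
      rw [div_eq_inv_mul, ← smul_smul, ← h1, smul_smul, inv_mul_cancel₀ hz1, one_smul])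
    rw [Complex.div_re, ← add_div, div_neg_iff] at h2
    have h3 : 0 < Complex.normSq (1 + z) := Complex.normSq_pos.2 hz1
    have h4 : (z - 1).re * (1 + z).re + (z - 1).im * (1 + z).im < 0 := by
      rcases h2 with h2 | h2
      · linarith [h2.2]
      · exact h2.1
    simp at h4
    rw [Complex.norm_eq_sqrt_sq_add_sq, Real.sqrt_lt' one_pos]
    nlinarith
  refine ⟨P, hP, posDef_of_re_pos ?_ fun v hv => ?_⟩
  · rw [Matrix.IsHermitian, Matrix.conjTranspose_neg, Matrix.conjTranspose_add,
      Matrix.conjTranspose_mul, Matrix.conjTranspose_mul, Matrix.conjTranspose_conjTranspose,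
      hP.isHermitian, add_comm]
  · have hv' : (1 - M) *ᵥ v ≠ 0 := fun h0 => hv (by
      have := congrArg ((1 - M)⁻¹ *ᵥ ·) h0
      simpa [Matrix.mulVec_mulVec, Matrix.nonsing_inv_mul _ hu] using this)
    have h1 := PosDef.re_pos hPW hv'
    -- Congruence by `1 - M` turns the Stein form of `W` into the Lyapunov form of `M`, since `W *
    -- (1 - M) = 1 + M`.
    have h2 : (1 - M)ᴴ * (P - Wᴴ * P * W) * (1 - M) = (2 : ℂ) • -(Mᴴ * P + P * M) := by
      have h3 : (1 - M)ᴴ * (P - Wᴴ * P * W) * (1 - M) =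
          (1 - M)ᴴ * P * (1 - M) - (W * (1 - M))ᴴ * P * (W * (1 - M)) := by
        generalize 1 - M = N
        rw [Matrix.conjTranspose_mul]
        noncomm_ring
      rw [h3, hW1]
      simp only [Matrix.conjTranspose_sub, Matrix.conjTranspose_add, Matrix.conjTranspose_one,
        two_smul]
      noncomm_ring
    have h4 : star ((1 - M) *ᵥ v) ⬝ᵥ ((P - Wᴴ * P * W) *ᵥ ((1 - M) *ᵥ v)) =
        2 * (star v ⬝ᵥ (-(Mᴴ * P + P * M) *ᵥ v)) := by
      rw [Matrix.star_mulVec, ← Matrix.dotProduct_mulVec, Matrix.mulVec_mulVec,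
        Matrix.mulVec_mulVec, h2, Matrix.smul_mulVec, dotProduct_smul, smul_eq_mul]
    rw [h4] at h1
    simpa using h1

/-- The Stein/Lyapunov inequality is solvable when all eigenvalues lie in the region. -/
theorem exists_steinForm {d : ℕ} (q : Propagation) (M : Matrix (Fin d) (Fin d) ℂ)
    (h : ∀ (z : ℂ) (v : Fin d → ℂ), v ≠ 0 → M *ᵥ v = z • v → InRegion q z) :
    ∃ P : Matrix (Fin d) (Fin d) ℂ, P.PosDef ∧ (-(steinForm q M P)).PosDef := by
  cases q with
  | derivative =>
    obtain ⟨P, hP, hP'⟩ := exists_lyapunov M h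
    exact ⟨P, hP, by simpa [steinForm, regionMatrix] using hP'⟩
  | shift =>
    obtain ⟨P, hP, hP'⟩ := exists_stein M h
    refine ⟨P, hP, ?_⟩
    have : -(steinForm .shift M P) = P - Mᴴ * P * M := by
      simp [steinForm, regionMatrix]
      abel
    rwa [this]

end StabilityMatrices

section Exponentials

/-! ### Exponentials and eigenvectors -/

/-- One factor `b` splits off the exponential series, leaving `k = ∑ bⁿ / (n + 1)!`. -/
theorem exists_exp_sub_one_eq_mul {A : Type*} [NormedRing A] [NormedAlgebra ℂ A] [CompleteSpace A]
    (b : A) : ∃ k, NormedSpace.exp b - 1 = k * b := by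
  have h := NormedSpace.exp_series_hasSum_exp' (𝕂 := ℂ) b
  have h1 := (hasSum_nat_add_iff' 1).2 h
  have hs : Summable fun n : ℕ => (((n + 1).factorial : ℂ)⁻¹) • b ^ n := by
    refine Summable.of_norm_bounded (NormedSpace.norm_expSeries_summable' (𝕂 := ℂ) b) fun n => ?_
    rw [norm_smul, norm_smul]
    refine mul_le_mul_of_nonneg_right ?_ (norm_nonneg _)
    rw [norm_inv, norm_inv, Complex.norm_natCast, Complex.norm_natCast]
    exact inv_anti₀ (by positivity) (by exact_mod_cast Nat.factorial_le (Nat.le_succ n))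
  refine ⟨_, HasSum.unique (f := fun n : ℕ => (((n + 1).factorial : ℂ)⁻¹) • b ^ (n + 1)) ?_
    ((hs.hasSum.mul_right b).congr_fun ?_)⟩
  · simpa using h1
  · intro n
    simp [pow_succ]

/-- The scalar `z` is central, so the factorization of `exp (a - z) - 1` can be multiplied by `e ^
z`. It transfers exact and approximate eigenvectors of `a` to its exponential. -/
theorem exists_exp_sub_algebraMap_eq_mul {A : Type*} [NormedRing A] [NormedAlgebra ℂ A]
    [CompleteSpace A] (a : A) (z : ℂ) :
    ∃ k, NormedSpace.exp a - algebraMap ℂ A (Complex.exp z) = k * (a - algebraMap ℂ A z) := by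
  obtain ⟨k, hk⟩ := exists_exp_sub_one_eq_mul (a - algebraMap ℂ A z)
  let _ := NormedAlgebra.restrictScalars ℚ ℂ A
  have h1 : NormedSpace.exp (algebraMap ℂ A z) = algebraMap ℂ A (Complex.exp z) := by
    rw [Complex.exp_eq_exp_ℂ, ← NormedSpace.algebraMap_exp_comm]
  have h2 : NormedSpace.exp a =
      algebraMap ℂ A (Complex.exp z) * NormedSpace.exp (a - algebraMap ℂ A z) := by
    rw [← h1, ← NormedSpace.exp_add_of_commute]
    · rw [add_sub_cancel]
    · exact (Algebra.commute_algebraMap_left z _)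
  refine ⟨algebraMap ℂ A (Complex.exp z) * k, ?_⟩
  rw [mul_assoc, ← hk, h2, mul_sub, mul_one]

open scoped Matrix.Norms.Operator

/-- The eigenvalues of the exponential of a matrix are exponentials of eigenvalues. -/
theorem exists_eigenvalue_of_exp {d : ℕ} {M : Matrix (Fin d) (Fin d) ℂ} {z : ℂ}
    (hz : z ∈ spectrum ℂ (NormedSpace.exp M)) :
    ∃ (μ : ℂ) (v : Fin d → ℂ), v ≠ 0 ∧ M *ᵥ v = μ • v ∧ Complex.exp μ = z := by
  obtain ⟨v, hv, hzv⟩ := (mem_spectrum_iff_exists_mulVec _ z).1 hz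
  -- The eigenspace of the exponential is invariant under the commuting matrix `M`, hence contains
  -- an eigenvector of `M`.
  let W := LinearMap.ker (Matrix.toLin' (NormedSpace.exp M) - z • 1)
  have hW : ∀ w, w ∈ W ↔ NormedSpace.exp M *ᵥ w = z • w := fun w => by
    simp [W, sub_eq_zero]
  have hcomm : Commute (NormedSpace.exp M) M := (Commute.refl M).exp_left
  have hinv : ∀ w ∈ W, Matrix.toLin' M w ∈ W := fun w hw => by
    rw [hW] at hw ⊢
    rw [Matrix.toLin'_apply, Matrix.mulVec_mulVec, hcomm.eq, ← Matrix.mulVec_mulVec, hw,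
      Matrix.mulVec_smul]
  have hnt : Nontrivial W := ⟨⟨⟨v, (hW v).2 hzv⟩, 0, fun h => hv (congrArg Subtype.val h)⟩⟩
  obtain ⟨μ, hμ⟩ := Module.End.exists_eigenvalue ((Matrix.toLin' M).restrict hinv)
  obtain ⟨w, hw⟩ := hμ.exists_hasEigenvector
  have hw0 : (w : Fin d → ℂ) ≠ 0 := fun h => hw.2 (Subtype.ext h)
  have hMw : M *ᵥ (w : Fin d → ℂ) = μ • (w : Fin d → ℂ) := congrArg Subtype.val hw.apply_eq_smul
  refine ⟨μ, w, hw0, hMw, ?_⟩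
  obtain ⟨k, hk⟩ := exists_exp_sub_algebraMap_eq_mul M μ
  have h1 := congrArg (· *ᵥ (w : Fin d → ℂ)) hk
  simp only [← Matrix.mulVec_mulVec, Matrix.sub_mulVec, Algebra.algebraMap_eq_smul_one,
    Matrix.smul_mulVec, Matrix.one_mulVec, hMw, sub_self, Matrix.mulVec_zero, sub_eq_zero] at h1
  exact (smul_left_injective ℂ hw0 (((hW w).1 w.2).symm.trans h1)).symm

/-! ### Homogeneous coordinates in terms of points of the unit circle -/

section Ops

variable {A B : Type*} [Ring A] [Algebra ℂ A] [Ring B] [Algebra ℂ B]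

/-- The second homogeneous coordinate, for the parametrization of `∂D` by the unit circle. -/
def denOp : Propagation → A → A
  | .derivative => fun u => (1 / 2 : ℂ) • (u - 1)
  | .shift => fun _ => 1

/-- The first homogeneous coordinate, for the parametrization of `∂D` by the unit circle. -/
def numOp : Propagation → A → A
  | .derivative => fun u => (1 / 2 : ℂ) • (u + 1)
  | .shift => fun u => u

theorem map_denOp (φ : A →ₐ[ℂ] B) (q : Propagation) (u : A) : φ (denOp q u) = denOp q (φ u) := by
  cases q <;> simp [denOp]

theorem map_numOp (φ : A →ₐ[ℂ] B) (q : Propagation) (u : A) : φ (numOp q u) = numOp q (φ u) := by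
  cases q <;> simp [numOp]

end Ops

/-- For a derivative, `δ = (u + 1) / (u - 1)` is imaginary, with `u = 1` going to infinity; for a
shift, `δ = u`. Equality of homogeneous coordinates only up to a factor `s` is what allows `u = 1`
to be treated like any other point. -/
theorem exists_boundary_of_norm_eq_one (q : Propagation) {u : ℂ} (hu : ‖u‖ = 1) :
    ∃ δ ∈ regionBoundary q, ∃ s : ℂ, s ≠ 0 ∧ denOp q u = s * den δ ∧ numOp q u = s * num δ := by
  cases q with
  | shift =>
    exact ⟨(u : OnePoint ℂ), (mem_regionBoundary_shift _).2 ⟨u, hu, rfl⟩, 1, one_ne_zero,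
      (one_mul _).symm, (one_mul _).symm⟩
  | derivative =>
    by_cases h1 : u = 1
    · refine ⟨OnePoint.infty, (mem_regionBoundary_derivative _).2 (Or.inl rfl), 1, one_ne_zero,
        ?_, ?_⟩
      · change (1 / 2 : ℂ) • (u - 1) = 1 * 0
        simp [h1]
      · change (1 / 2 : ℂ) • (u + 1) = 1 * 1
        rw [h1, smul_eq_mul]
        norm_num
    · have h2 : u - 1 ≠ 0 := sub_ne_zero.2 h1
      refine ⟨(((u + 1) / (u - 1) : ℂ) : OnePoint ℂ),
        (mem_regionBoundary_derivative _).2 (Or.inr ⟨((u + 1) / (u - 1)).im, ?_⟩), (u - 1) / 2,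
        div_ne_zero h2 two_ne_zero, ?_, ?_⟩
      · congr 1
        have hre : ((u + 1) / (u - 1)).re = 0 := by
          rw [Complex.div_re, ← add_div, div_eq_zero_iff]
          left
          have h3 : Complex.normSq u = 1 := by rw [Complex.normSq_eq_norm_sq, hu, one_pow]
          rw [Complex.normSq_apply] at h3
          simp
          linarith
        apply Complex.ext <;> simp [hre]
      · change (1 / 2 : ℂ) • (u - 1) = (u - 1) / 2 * 1
        rw [smul_eq_mul]
        ring
      · change (1 / 2 : ℂ) • (u + 1) = (u - 1) / 2 * ((u + 1) / (u - 1))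
        rw [smul_eq_mul]
        field_simp

/-- The inverse Cayley map: `iω` comes from `(iω + 1) / (iω - 1)` and infinity from `1`. -/
theorem exists_norm_eq_one_of_boundary (q : Propagation) {δ : OnePoint ℂ}
    (hδ : δ ∈ regionBoundary q) :
    ∃ u : ℂ, ‖u‖ = 1 ∧ ∃ s : ℂ, s ≠ 0 ∧ denOp q u = s * den δ ∧ numOp q u = s * num δ := by
  cases q with
  | shift =>
    obtain ⟨u, hu, rfl⟩ := (mem_regionBoundary_shift _).1 hδ
    exact ⟨u, hu, 1, one_ne_zero, (one_mul _).symm, (one_mul _).symm⟩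
  | derivative =>
    rcases (mem_regionBoundary_derivative _).1 hδ with rfl | ⟨ω, rfl⟩
    · refine ⟨1, norm_one, 1, one_ne_zero, ?_, ?_⟩
      · change (1 / 2 : ℂ) • ((1 : ℂ) - 1) = 1 * 0
        simp
      · change (1 / 2 : ℂ) • ((1 : ℂ) + 1) = 1 * 1
        rw [smul_eq_mul]
        norm_num
    · have h1 : (ω * Complex.I - 1 : ℂ) ≠ 0 := fun h => by simpa using congrArg Complex.re h
      refine ⟨(ω * Complex.I + 1) / (ω * Complex.I - 1), ?_, 1 / (ω * Complex.I - 1),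
        one_div_ne_zero h1, ?_, ?_⟩
      · rw [norm_div, div_eq_one_iff_eq (norm_ne_zero_iff.2 h1),
          Complex.norm_eq_sqrt_sq_add_sq, Complex.norm_eq_sqrt_sq_add_sq]
        simp
      · change (1 / 2 : ℂ) • (_ - 1) = _ * 1
        rw [smul_eq_mul]
        field_simp
        ring
      · change (1 / 2 : ℂ) • (_ + 1) = _ * (ω * Complex.I)
        rw [smul_eq_mul]
        field_simp
        ring

/-! ### The matrix `M` over a commutative algebra -/

namespace Model

variable {m : ℕ} (S : Model m) {A B : Type*} [CommRing A] [Algebra ℂ A] [CommRing B] [Algebra ℂ B]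

/-- Denominators, as functions of operators that parametrize the boundaries. -/
def opDen (U : Fin m → A) : Matrix S.Rest S.Rest A :=
  Matrix.diagonal fun a => denOp (S.qs a.1) (U a.1)

/-- Numerators, as functions of operators that parametrize the boundaries. -/
def opNum (U : Fin m → A) : Matrix S.Rest S.Rest A :=
  Matrix.diagonal fun a => numOp (S.qs a.1) (U a.1)

/-- The pencil over a commutative algebra. -/
def opPencil (U : Fin m → A) : Matrix S.Rest S.Rest A :=
  S.opDen U - S.opNum U * S.AM.map (algebraMap ℂ A)

/-- The transfer matrix from the first state subvector to the others. -/
def opG (U : Fin m → A) : Matrix S.Rest (Fin (S.k 0)) A :=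
  (S.opPencil U)⁻¹ * (S.opNum U * S.BM.map (algebraMap ℂ A))

/-- The matrix `M` over a commutative algebra. -/
def opM (U : Fin m → A) : Matrix (Fin (S.k 0)) (Fin (S.k 0)) A :=
  S.DM.map (algebraMap ℂ A) + S.CM.map (algebraMap ℂ A) * S.opG U

variable {S}

theorem map_opDen (φ : A →ₐ[ℂ] B) (U : Fin m → A) :
    (S.opDen U).map φ = S.opDen fun i => φ (U i) := by
  simp [opDen, Matrix.diagonal_map, map_denOp]

theorem map_opNum (φ : A →ₐ[ℂ] B) (U : Fin m → A) :
    (S.opNum U).map φ = S.opNum fun i => φ (U i) := by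
  simp [opNum, Matrix.diagonal_map, map_numOp]

theorem map_map_algebraMap {n p : Type*} (φ : A →ₐ[ℂ] B) (T : Matrix n p ℂ) :
    (T.map (algebraMap ℂ A)).map φ = T.map (algebraMap ℂ B) := by
  ext i j
  simp

theorem map_opPencil (φ : A →ₐ[ℂ] B) (U : Fin m → A) :
    (S.opPencil U).map φ = S.opPencil fun i => φ (U i) := by
  rw [opPencil, opPencil, Matrix.map_sub _ (map_sub φ), Matrix.map_mul, map_opDen, map_opNum,
    map_map_algebraMap]

theorem map_det_opPencil (φ : A →ₐ[ℂ] B) (U : Fin m → A) :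
    φ (S.opPencil U).det = (S.opPencil fun i => φ (U i)).det := by
  rw [← map_opPencil]
  exact AlgHom.map_det φ _

/-- A homomorphism carries inverses to inverses where they exist; for a singular pencil the matrix
`⁻¹` is zero by convention, hence the hypothesis on the determinant. -/
theorem map_opG (φ : A →ₐ[ℂ] B) {U : Fin m → A} (hU : IsUnit (S.opPencil U).det) :
    (S.opG U).map φ = S.opG fun i => φ (U i) := by
  have h1 : ((S.opPencil U)⁻¹).map φ = (S.opPencil fun i => φ (U i))⁻¹ := by
    refine (Matrix.inv_eq_left_inv ?_).symm
    rw [← map_opPencil, ← Matrix.map_mul, Matrix.nonsing_inv_mul _ hU]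
    exact Matrix.map_one _ (map_zero φ) (map_one φ)
  rw [opG, opG, Matrix.map_mul, Matrix.map_mul, map_opNum, map_map_algebraMap, h1]

theorem map_opM (φ : A →ₐ[ℂ] B) {U : Fin m → A} (hU : IsUnit (S.opPencil U).det) :
    (S.opM U).map φ = S.opM fun i => φ (U i) := by
  rw [opM, opM, Matrix.map_add _ (map_add φ), Matrix.map_mul, map_opG φ hU, map_map_algebraMap,
    map_map_algebraMap]

/-! ### Independence of the choice of homogeneous coordinates -/

section Scalars

variable {u : Fin m → ℂ} {δ : Fin m → OnePoint ℂ} {s : Fin m → ℂ}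

/-- Rescaling the coordinates of `δ i` multiplies a block row of the pencil by the same factor as
that block row of the numerators. Nonzero factors thus change neither invertibility nor `M`. -/
theorem opPencil_eq_of_coordinates (hd : ∀ i, denOp (S.qs i) (u i) = s i * den (δ i))
    (hn : ∀ i, numOp (S.qs i) (u i) = s i * num (δ i)) :
    S.opPencil u = Matrix.diagonal (fun a : S.Rest => s a.1) * S.pencil δ := by
  have h : S.AM.map (algebraMap ℂ ℂ) = S.AM := Matrix.map_id _
  rw [opPencil, pencil, mul_sub, ← mul_assoc, denMat, numMat, Matrix.diagonal_mul_diagonal,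
    Matrix.diagonal_mul_diagonal, h, opDen, opNum]
  simp only [hd, hn]

theorem isUnit_det_opPencil_of_coordinates (hs : ∀ i, s i ≠ 0) (hδ : IsUnit (S.pencil δ).det)
    (hd : ∀ i, denOp (S.qs i) (u i) = s i * den (δ i))
    (hn : ∀ i, numOp (S.qs i) (u i) = s i * num (δ i)) : IsUnit (S.opPencil u).det := by
  rw [opPencil_eq_of_coordinates hd hn, Matrix.det_mul, Matrix.det_diagonal]
  exact (isUnit_iff_ne_zero.2 (Finset.prod_ne_zero_iff.2 fun a _ => hs a.1)).mul hδ

theorem opM_eq_of_coordinates (hs : ∀ i, s i ≠ 0)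
    (hd : ∀ i, denOp (S.qs i) (u i) = s i * den (δ i))
    (hn : ∀ i, numOp (S.qs i) (u i) = s i * num (δ i)) : S.opM u = S.M δ := by
  have hm : ∀ {n p : Type} (T : Matrix n p ℂ), T.map (algebraMap ℂ ℂ) = T := fun T =>
    Matrix.map_id _
  have hu : IsUnit (Matrix.diagonal (fun a : S.Rest => s a.1)).det := by
    rw [Matrix.det_diagonal]
    exact isUnit_iff_ne_zero.2 (Finset.prod_ne_zero_iff.2 fun a _ => hs a.1)
  have h2 : S.opNum u = Matrix.diagonal (fun a : S.Rest => s a.1) * S.numMat δ := by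
    rw [numMat, Matrix.diagonal_mul_diagonal, opNum]
    simp only [hn]
  rw [opM, M, opG, hm, hm, hm, opPencil_eq_of_coordinates hd hn, h2, Matrix.mul_inv_rev]
  simp only [Matrix.mul_assoc]
  congr 3
  rw [← Matrix.mul_assoc, Matrix.nonsing_inv_mul _ hu,
    Matrix.one_mul]

end Scalars

end Model

end Exponentials

section Characters

/-! ### Characters and decay -/

/-- The operator that advances a solution by one unit of time. -/
def stepOp {B : Type*} [NormedRing B] [NormedAlgebra ℂ B] : Propagation → B → B
  | .derivative => NormedSpace.exp
  | .shift => id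

namespace Model

variable {m : ℕ} {S : Model m}

theorem WellPosed.exists_boundary (hS : S.WellPosed) {u : Fin m → ℂ} (hu : ∀ i, ‖u i‖ = 1) :
    IsUnit (S.opPencil u).det ∧ ∃ δ ∈ S.boundary, S.opM u = S.M δ := by
  choose δ hδ s hs hd hn using fun i => exists_boundary_of_norm_eq_one (S.qs i) (hu i)
  exact ⟨isUnit_det_opPencil_of_coordinates hs (hS δ hδ) hd hn, δ, hδ,
    opM_eq_of_coordinates hs hd hn⟩

theorem WellPosed.exists_circle (hS : S.WellPosed) {δ : Fin m → OnePoint ℂ}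
    (hδ : δ ∈ S.boundary) :
    ∃ u : Fin m → ℂ, (∀ i, ‖u i‖ = 1) ∧ IsUnit (S.opPencil u).det ∧ S.opM u = S.M δ := by
  choose u hu s hs hd hn using fun i => exists_norm_eq_one_of_boundary (S.qs i) (hδ i)
  exact ⟨u, hu, isUnit_det_opPencil_of_coordinates hs (hS δ hδ) hd hn,
    opM_eq_of_coordinates hs hd hn⟩

/-! ### Gelfand theory for the pencil and for the time step -/

section Banach

variable {A : Type*} [NormedCommRing A] [NormedAlgebra ℂ A] [CompleteSpace A]

/-- Characters do not increase the norm bound 1; applied to `u` and to its inverse, this leaves only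
modulus 1. -/
theorem norm_character_eq_one (h1 : ‖(1 : A)‖ ≤ 1) {u u' : A} (hu : ‖u‖ ≤ 1) (hu' : ‖u'‖ ≤ 1)
    (huu' : u * u' = 1) (φ : WeakDual.characterSpace ℂ A) : ‖φ u‖ = 1 := by
  have hle : ∀ a : A, ‖a‖ ≤ 1 → ‖φ a‖ ≤ 1 := fun a ha => by
    have := spectrum.norm_le_norm_mul_of_mem (WeakDual.CharacterSpace.apply_mem_spectrum φ a)
    nlinarith [norm_nonneg a, norm_nonneg (1 : A)]
  have h2 : ‖φ u‖ * ‖φ u'‖ = 1 := by rw [← norm_mul, ← map_mul, huu', map_one, norm_one]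
  have := hle u hu
  have := hle u' hu'
  nlinarith [norm_nonneg (φ u), norm_nonneg (φ u')]

variable {u u' : Fin m → A}

/-- A nonunit of a commutative Banach algebra is killed by some character. The image of the
determinant under a character is a scalar pencil determinant at a point of the torus, which
well-posedness keeps nonzero. -/
theorem WellPosed.isUnit_det_opPencil (hS : S.WellPosed) (h1 : ‖(1 : A)‖ ≤ 1)
    (hu : ∀ i, ‖u i‖ ≤ 1) (hu' : ∀ i, ‖u' i‖ ≤ 1) (huu' : ∀ i, u i * u' i = 1) :
    IsUnit (S.opPencil u).det := by
  by_contra h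
  obtain ⟨φ, hφ⟩ := WeakDual.CharacterSpace.exists_apply_eq_zero h
  have h2 := (hS.exists_boundary fun i => norm_character_eq_one h1 (hu i) (hu' i) (huu' i) φ).1
  have h3 := map_det_opPencil (S := S) (WeakDual.CharacterSpace.toAlgHom φ) u
  change φ _ = _ at h3
  rw [hφ] at h3
  rw [isUnit_iff_ne_zero] at h2
  exact h2 h3.symm

open scoped Matrix.Norms.Operator in
theorem completeSpace_matrix (d : ℕ) (A : Type*) [NormedRing A] [CompleteSpace A] :
    @CompleteSpace (Matrix (Fin d) (Fin d) A) PseudoMetricSpace.toUniformSpace :=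
  inferInstanceAs (CompleteSpace (Fin d → Fin d → A))

-- A spectral value `z` of `Φ T` makes `det (z - T)` a nonunit, so a character `φ` kills it and `z`
-- is an eigenvalue of the scalar matrix `φ(T)`. With `T = M(u)` or its exponential, `φ(T)` is
-- `M(δ)` or `exp M(δ)`, whose eigenvalues lie in the open disc. Continuity of `Φ` serves to commute
-- it with the exponential.
open scoped Matrix.Norms.Operator in
theorem WellPosed.tendsto_norm_stepOp_pow (hS : S.WellPosed) (h1 : ‖(1 : A)‖ ≤ 1)
    (hu : ∀ i, ‖u i‖ ≤ 1) (hu' : ∀ i, ‖u' i‖ ≤ 1) (huu' : ∀ i, u i * u' i = 1)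
    (hM : ∀ δ ∈ S.boundary, ∀ (z : ℂ) (v : Fin (S.k 0) → ℂ), v ≠ 0 → S.M δ *ᵥ v = z • v →
      InRegion (S.q 0) z)
    {B : Type*} [NormedRing B] [NormedAlgebra ℂ B] [CompleteSpace B]
    (Φ : Matrix (Fin (S.k 0)) (Fin (S.k 0)) A →ₐ[ℂ] B) (hΦ : Continuous Φ) :
    Tendsto (fun n : ℕ => ‖stepOp (S.q 0) (Φ (S.opM u)) ^ n‖) atTop (𝓝 0) := by
  have hchar : ∀ (T : Matrix (Fin (S.k 0)) (Fin (S.k 0)) A) (z : ℂ), z ∈ spectrum ℂ (Φ T) →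
      ∃ φ : WeakDual.characterSpace ℂ A,
        z ∈ spectrum ℂ ((WeakDual.CharacterSpace.toAlgHom φ).mapMatrix T) := by
    intro T z hz
    have h2 := AlgHom.spectrum_apply_subset Φ T hz
    rw [spectrum.mem_iff, Matrix.isUnit_iff_isUnit_det] at h2
    obtain ⟨φ, hφ⟩ := WeakDual.CharacterSpace.exists_apply_eq_zero h2
    refine ⟨φ, ?_⟩
    rw [spectrum.mem_iff, Matrix.isUnit_iff_isUnit_det, isUnit_iff_ne_zero, not_not]
    have h3 := AlgHom.map_det (WeakDual.CharacterSpace.toAlgHom φ)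
      (algebraMap ℂ (Matrix (Fin (S.k 0)) (Fin (S.k 0)) A) z - T)
    rw [map_sub, AlgHom.commutes] at h3
    rw [← h3]
    exact hφ
  have hφM : ∀ φ : WeakDual.characterSpace ℂ A, ∃ δ ∈ S.boundary,
      (WeakDual.CharacterSpace.toAlgHom φ).mapMatrix (S.opM u) = S.M δ := fun φ => by
    obtain ⟨-, δ, hδ, h⟩ :=
      hS.exists_boundary fun i => norm_character_eq_one h1 (hu i) (hu' i) (huu' i) φ
    exact ⟨δ, hδ, (map_opM (WeakDual.CharacterSpace.toAlgHom φ)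
      (hS.isUnit_det_opPencil h1 hu hu' huu')).trans h⟩
  apply tendsto_norm_pow_of_spectrum
  intro z hz
  generalize S.q 0 = q at hM hz
  cases q with
  | shift =>
    obtain ⟨φ, hφ⟩ := hchar _ z hz
    obtain ⟨δ, hδ, h⟩ := hφM φ
    rw [h] at hφ
    obtain ⟨v, hv, hv'⟩ := (mem_spectrum_iff_exists_mulVec _ _).1 hφ
    exact hM δ hδ z v hv hv'
  | derivative =>
    let _ := NormedAlgebra.restrictScalars ℚ ℂ A
    let _ := NormedAlgebra.restrictScalars ℚ ℂ B
    have hcs := completeSpace_matrix (S.k 0) A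
    have h2 : stepOp .derivative (Φ (S.opM u)) = Φ (NormedSpace.exp (S.opM u)) :=
      (NormedSpace.map_exp Φ hΦ _).symm
    rw [h2] at hz
    obtain ⟨φ, hφ⟩ := hchar _ z hz
    obtain ⟨δ, hδ, h⟩ := hφM φ
    have hc : Continuous ((WeakDual.CharacterSpace.toAlgHom φ).mapMatrix :
        Matrix (Fin (S.k 0)) (Fin (S.k 0)) A →ₐ[ℂ] Matrix (Fin (S.k 0)) (Fin (S.k 0)) ℂ) :=
      continuous_id.matrix_map (map_continuous φ)
    have h4 : (WeakDual.CharacterSpace.toAlgHom φ).mapMatrix (NormedSpace.exp (S.opM u)) =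
        NormedSpace.exp (S.M δ) := (NormedSpace.map_exp _ hc _).trans (by rw [h]; rfl)
    rw [h4] at hφ
    obtain ⟨μ, v, hv, hv', rfl⟩ := exists_eigenvalue_of_exp hφ
    have := hM δ hδ μ v hv hv'
    rw [Complex.norm_exp]
    exact Real.exp_lt_one_iff.2 this

end Banach

end Model

/-! ### Matrices of operators -/

section MatAct

variable {H : Type*} [NormedAddCommGroup H] [NormedSpace ℂ H]
  {A : Type*} [NormedCommRing A] [NormedAlgebra ℂ A] (ι : A →ₐ[ℂ] (H →L[ℂ] H))
  {n p r : Type*} [Fintype p]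

/-- The action of a matrix over an algebra of operators on vectors. -/
def matAct (T : Matrix n p A) : (p → H) →L[ℂ] (n → H) :=
  ContinuousLinearMap.pi fun a => ∑ b, (ι (T a b)).comp (ContinuousLinearMap.proj b)

theorem matAct_apply (T : Matrix n p A) (x : p → H) (a : n) :
    matAct ι T x a = ∑ b, ι (T a b) (x b) := by
  simp [matAct]

theorem matAct_mul [Fintype r] (T : Matrix n p A) (T' : Matrix p r A) (x : r → H) :
    matAct ι (T * T') x = matAct ι T (matAct ι T' x) := by
  ext1 a
  simp only [matAct_apply, Matrix.mul_apply, map_sum, map_mul]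
  rw [Finset.sum_comm]
  simp

theorem matAct_add (T T' : Matrix n p A) (x : p → H) :
    matAct ι (T + T') x = matAct ι T x + matAct ι T' x := by
  ext1 a
  simp [matAct_apply, Finset.sum_add_distrib]

theorem matAct_sub (T T' : Matrix n p A) (x : p → H) :
    matAct ι (T - T') x = matAct ι T x - matAct ι T' x := by
  ext1 a
  simp [matAct_apply, Finset.sum_sub_distrib]

theorem matAct_diagonal [Fintype n] [DecidableEq n] (d : n → A) (x : n → H) (a : n) :
    matAct ι (Matrix.diagonal d) x a = ι (d a) (x a) := by
  rw [matAct_apply, Finset.sum_eq_single a]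
  · simp
  · intro b _ hb
    simp [Matrix.diagonal_apply_ne _ hb.symm]
  · simp

theorem matAct_one [Fintype n] [DecidableEq n] (x : n → H) : matAct ι (1 : Matrix n n A) x = x := by
  ext1 a
  rw [← Matrix.diagonal_one, matAct_diagonal]
  simp

theorem matAct_map (T : Matrix n p ℂ) (x : p → H) (a : n) :
    matAct ι (T.map (algebraMap ℂ A)) x a = ∑ b, T a b • x b := by
  simp [matAct_apply, Algebra.algebraMap_eq_smul_one]

/-- The action of square matrices over an algebra of operators, as a homomorphism of algebras. -/
def matActHom (n : Type*) [Fintype n] [DecidableEq n] :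
    Matrix n n A →ₐ[ℂ] ((n → H) →L[ℂ] (n → H)) where
  toFun T := matAct ι T
  map_one' := ContinuousLinearMap.ext fun x => matAct_one ι x
  map_mul' T T' := ContinuousLinearMap.ext fun x => matAct_mul ι T T' x
  map_zero' := by
    ext x a
    simp [matAct_apply]
  map_add' T T' := ContinuousLinearMap.ext fun x => matAct_add ι T T' x
  commutes' z := by
    ext x a
    rw [Matrix.algebraMap_eq_diagonal, matAct_diagonal]
    simp [Algebra.algebraMap_eq_smul_one]

-- The action is a finite sum of compositions of `ι (T a b)` with fixed inclusions and projections,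
-- each continuous in the operator norm.
open scoped Matrix.Norms.Operator in
theorem continuous_matActHom (hι : Continuous ι) (n : Type*) [Fintype n] [DecidableEq n] :
    Continuous (matActHom ι n) := by
  have h : ∀ f : n → n → H →L[ℂ] H,
      ContinuousLinearMap.pi (fun a => ∑ b, (f a b).comp
        (ContinuousLinearMap.proj (φ := fun _ : n => H) b)) =
      ∑ a, ∑ b, (ContinuousLinearMap.single ℂ (fun _ : n => H) a).comp
        ((f a b).comp (ContinuousLinearMap.proj (φ := fun _ : n => H) b)) := by
    intro f
    refine ContinuousLinearMap.ext fun x => funext fun c => ?_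
    simp only [ContinuousLinearMap.coe_pi', _root_.sum_apply, ContinuousLinearMap.comp_apply,
      ContinuousLinearMap.single_apply, ContinuousLinearMap.proj_apply, Finset.sum_apply]
    symm
    rw [Finset.sum_eq_single c (fun a _ ha => by simp [Pi.single_eq_of_ne ha.symm]) (by simp)]
    simp
  change Continuous fun T : Matrix n n A => ContinuousLinearMap.pi _
  simp only [h]
  refine continuous_finsetSum _ fun a _ => continuous_finsetSum _ fun b _ => ?_
  exact continuous_const.clm_comp ((hι.comp (continuous_id.matrix_elem a b)).clm_comp
    continuous_const)

/-! ### Approximate eigenvectors -/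

/-- The vectors `w n` are approximate eigenvectors of the operator `T` for the value `c`. -/
def ApproxEigen (w : ℕ → H) (T : H →L[ℂ] H) (c : ℂ) : Prop :=
  Tendsto (fun n => T (w n) - c • w n) atTop (𝓝 0)

variable {w : ℕ → H} {T T' : H →L[ℂ] H} {c c' : ℂ}

theorem ApproxEigen.add (h : ApproxEigen w T c) (h' : ApproxEigen w T' c') :
    ApproxEigen w (T + T') (c + c') := by
  have := Tendsto.add h h'
  rw [add_zero] at this
  refine this.congr fun n => ?_
  rw [_root_.add_apply, add_smul]
  abel

theorem approxEigen_smul_one (w : ℕ → H) (c : ℂ) : ApproxEigen w (c • 1) c := by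
  simp [ApproxEigen]

/-- For the value zero the left factor may be any bounded operator. This handles a factor, such as
an inverse, about which nothing is known yet. -/
theorem ApproxEigen.mul_of_zero (T : H →L[ℂ] H) (h' : ApproxEigen w T' 0) :
    ApproxEigen w (T * T') 0 := by
  have := (T.continuous.tendsto 0).comp h'
  rw [map_zero] at this
  refine this.congr fun n => ?_
  simp

/-- `T T' w - c c' w = T (T' w - c' w) + c' (T w - c w)`. -/
theorem ApproxEigen.mul (h : ApproxEigen w T c) (h' : ApproxEigen w T' c') :
    ApproxEigen w (T * T') (c * c') := by
  have h1 := (T.continuous.tendsto 0).comp h'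
  have := h1.add (h.const_smul c')
  rw [map_zero, smul_zero, add_zero] at this
  refine this.congr fun n => ?_
  simp only [Function.comp_apply, map_sub, map_smul, smul_sub, smul_smul,
    mul_apply_eq_comp, mul_comm c']
  abel

theorem ApproxEigen.smul (h : ApproxEigen w T c) (a : ℂ) : ApproxEigen w (a • T) (a * c) := by
  simpa using (approxEigen_smul_one w a).mul h

theorem ApproxEigen.neg (h : ApproxEigen w T c) : ApproxEigen w (-T) (-c) := by
  simpa using h.smul (-1)

theorem ApproxEigen.sub (h : ApproxEigen w T c) (h' : ApproxEigen w T' c') :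
    ApproxEigen w (T - T') (c - c') := by
  simpa only [sub_eq_add_neg] using h.add h'.neg

theorem ApproxEigen.sum {α : Type*} (s : Finset α) {T : α → H →L[ℂ] H} {c : α → ℂ}
    (h : ∀ i ∈ s, ApproxEigen w (T i) (c i)) : ApproxEigen w (∑ i ∈ s, T i) (∑ i ∈ s, c i) := by
  classical
  induction s using Finset.induction_on with
  | empty => simp [ApproxEigen]
  | insert i s hi ih =>
    rw [Finset.sum_insert hi, Finset.sum_insert hi]
    exact (h i (Finset.mem_insert_self i s)).add
      (ih fun j hj => h j (Finset.mem_insert_of_mem hj))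

theorem ApproxEigen.one (w : ℕ → H) : ApproxEigen w (1 : H →L[ℂ] H) 1 := by
  simp [ApproxEigen]

theorem ApproxEigen.denOp (h : ApproxEigen w T c) (q : Propagation) :
    ApproxEigen w (denOp q T) (denOp q c) := by
  cases q with
  | shift => exact ApproxEigen.one w
  | derivative => exact (h.sub (ApproxEigen.one w)).smul _

theorem ApproxEigen.numOp (h : ApproxEigen w T c) (q : Propagation) :
    ApproxEigen w (numOp q T) (numOp q c) := by
  cases q with
  | shift => exact h
  | derivative => exact (h.add (ApproxEigen.one w)).smul _

/-- Entrywise approximate eigenvectors of a matrix over an algebra of operators. -/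
def ApproxMat (w : ℕ → H) (T : Matrix n p A) (M : Matrix n p ℂ) : Prop :=
  ∀ a b, ApproxEigen w (ι (T a b)) (M a b)

variable {ι}

theorem ApproxMat.mul {T : Matrix n p A} {T' : Matrix p r A} {M : Matrix n p ℂ}
    {M' : Matrix p r ℂ} (h : ApproxMat ι w T M) (h' : ApproxMat ι w T' M') :
    ApproxMat ι w (T * T') (M * M') := fun a b => by
  simp only [Matrix.mul_apply, map_sum, map_mul]
  exact ApproxEigen.sum _ fun i _ => (h a i).mul (h' i b)

theorem ApproxMat.mul_of_zero (T : Matrix n p A) {T' : Matrix p r A}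
    (h' : ApproxMat ι w T' 0) : ApproxMat ι w (T * T') 0 := fun a b => by
  simp only [Matrix.mul_apply, map_sum, map_mul]
  have := ApproxEigen.sum Finset.univ (w := w) (T := fun i => ι (T a i) * ι (T' i b))
    (c := fun _ => 0) fun i _ => (h' i b).mul_of_zero _
  simpa using this

omit [Fintype p] in
theorem ApproxMat.add {T T' : Matrix n p A} {M M' : Matrix n p ℂ}
    (h : ApproxMat ι w T M) (h' : ApproxMat ι w T' M') :
    ApproxMat ι w (T + T') (M + M') := fun a b => by
  simpa using (h a b).add (h' a b)

omit [Fintype p] in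
theorem ApproxMat.sub {T T' : Matrix n p A} {M M' : Matrix n p ℂ}
    (h : ApproxMat ι w T M) (h' : ApproxMat ι w T' M') :
    ApproxMat ι w (T - T') (M - M') := fun a b => by
  simpa using (h a b).sub (h' a b)

omit [Fintype p] in
theorem ApproxMat.map (w : ℕ → H) (M : Matrix n p ℂ) :
    ApproxMat ι w (M.map (algebraMap ℂ A)) M := fun a b => by
  simpa [AlgHom.commutes, Algebra.algebraMap_eq_smul_one] using approxEigen_smul_one w (M a b)

theorem ApproxMat.diagonal [DecidableEq n] {d : n → A} {c : n → ℂ}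
    (h : ∀ a, ApproxEigen w (ι (d a)) (c a)) :
    ApproxMat ι w (Matrix.diagonal d) (Matrix.diagonal c) := fun a b => by
  by_cases hab : a = b
  · subst hab
    simpa using h a
  · simp [Matrix.diagonal_apply_ne _ hab, ApproxEigen]

/-- The identity `T⁻¹ = T⁻¹ (M - T) M⁻¹ + M⁻¹` reduces the claim to `M - T`, which has approximate
value zero, so boundedness of `T⁻¹` is enough. -/
theorem ApproxMat.inv [Fintype n] [DecidableEq n] {T : Matrix n n A} {M : Matrix n n ℂ}
    (h : ApproxMat ι w T M) (hT : IsUnit T.det) (hM : IsUnit M.det) :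
    ApproxMat ι w T⁻¹ M⁻¹ := by
  have h1 : T⁻¹ = T⁻¹ * ((M.map (algebraMap ℂ A) - T) * M⁻¹.map (algebraMap ℂ A)) +
      M⁻¹.map (algebraMap ℂ A) := by
    rw [sub_mul, ← Matrix.map_mul, Matrix.mul_nonsing_inv _ hM,
      Matrix.map_one _ (map_zero _) (map_one _), mul_sub, ← mul_assoc,
      Matrix.nonsing_inv_mul _ hT, one_mul, mul_one, sub_add_cancel]
  have h2 : ApproxMat ι w ((M.map (algebraMap ℂ A) - T) * M⁻¹.map (algebraMap ℂ A)) 0 := by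
    have := ((ApproxMat.map (ι := ι) w M).sub h).mul (ApproxMat.map (ι := ι) w M⁻¹)
    rwa [sub_self, zero_mul] at this
  rw [h1]
  simpa using (ApproxMat.mul_of_zero T⁻¹ h2).add (ApproxMat.map (ι := ι) w M⁻¹)

theorem ApproxMat.tendsto_matAct {T : Matrix n p A} {M : Matrix n p ℂ} (h : ApproxMat ι w T M)
    (v : p → ℂ) :
    Tendsto (fun j => matAct ι T (fun b => v b • w j) - fun a => (M *ᵥ v) a • w j) atTop
      (𝓝 0) := by
  refine tendsto_pi_nhds.2 fun a => ?_
  have h1 : Tendsto (fun j => ∑ b, v b • (ι (T a b) (w j) - M a b • w j)) atTop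
      (𝓝 (∑ b : p, v b • (0 : H))) :=
    tendsto_finsetSum _ fun b _ => (h a b).const_smul (v b)
  simp only [smul_zero, Finset.sum_const_zero] at h1
  refine h1.congr fun j => ?_
  simp only [Pi.sub_apply, matAct_apply, map_smul, smul_sub, Finset.sum_sub_distrib,
    Matrix.mulVec, dotProduct, Finset.sum_smul, smul_smul, mul_comm]

/-- `M` is built from the `u i` by sums, products and one inverse, and simultaneous approximate
eigenvectors survive each of these. -/
theorem Model.approxMat_opM {m : ℕ} {S : Model m} {u : Fin m → A} {c : Fin m → ℂ}
    (hu : IsUnit (S.opPencil u).det) (hc : IsUnit (S.opPencil c).det)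
    (h : ∀ i, ApproxEigen w (ι (u i)) (c i)) : ApproxMat ι w (S.opM u) (S.opM c) := by
  have hid : ∀ {n p : Type} (T : Matrix n p ℂ), T.map (algebraMap ℂ ℂ) = T := fun T =>
    Matrix.map_id _
  have hnum : ApproxMat ι w (S.opNum u) (S.opNum c) := ApproxMat.diagonal fun a => by
    rw [map_numOp]
    exact (h a.1).numOp _
  have hden : ApproxMat ι w (S.opDen u) (S.opDen c) := ApproxMat.diagonal fun a => by
    rw [map_denOp]
    exact (h a.1).denOp _
  have hpen : ApproxMat ι w (S.opPencil u) (S.opPencil c) := by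
    refine hden.sub ?_
    rw [hid]
    exact hnum.mul (ApproxMat.map w _)
  rw [opM, opM, opG, opG, hid, hid, hid]
  exact (ApproxMat.map w _).add ((ApproxMat.map w _).mul ((hpen.inv hu hc).mul
    (hnum.mul (ApproxMat.map w _))))

end MatAct

end Characters

section Operators

/-! ### The operator form of the model -/

/-- Commuting operators lie in a closed commutative algebra. -/
theorem exists_commutative_algebra {H : Type*} [NormedAddCommGroup H] [NormedSpace ℂ H]
    (s : Set (H →L[ℂ] H)) (hs : ∀ a ∈ s, ∀ b ∈ s, a * b = b * a) :
    ∃ 𝒜 : Subalgebra ℂ (H →L[ℂ] H), s ⊆ 𝒜 ∧ IsClosed (𝒜 : Set (H →L[ℂ] H)) ∧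
      ∀ a b : 𝒜, a * b = b * a := by
  have h1 := Algebra.isMulCommutative_adjoin ℂ hs
  have h2 : ∀ x y : Algebra.adjoin ℂ s, x * y = y * x := fun x y => mul_comm' x y
  let _ := Subalgebra.commRingTopologicalClosure (Algebra.adjoin ℂ s) h2
  exact ⟨(Algebra.adjoin ℂ s).topologicalClosure,
    Algebra.subset_adjoin.trans (Subalgebra.le_topologicalClosure _),
    Subalgebra.isClosed_topologicalClosure _, fun a b => mul_comm a b⟩

variable {m : ℕ} {S : Model m}

section Operator

variable {H : Type*} [NormedAddCommGroup H] [NormedSpace ℂ H] [CompleteSpace H]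

omit [CompleteSpace H] in
theorem Model.matAct_opPencil_eq_iff {A : Type*} [NormedCommRing A] [NormedAlgebra ℂ A]
    (ι : A →ₐ[ℂ] (H →L[ℂ] H)) (u : Fin m → A) (X : Fin (S.k 0) → H) (Y : S.Rest → H) :
    (∀ a : S.Rest, denOp (S.qs a.1) (ι (u a.1)) (Y a) = numOp (S.qs a.1) (ι (u a.1))
      (∑ b, S.AM a b • Y b + ∑ b, S.BM a b • X b)) ↔
    matAct ι (S.opPencil u) Y = matAct ι (S.opNum u * S.BM.map (algebraMap ℂ A)) X := by
  rw [Model.opPencil, matAct_sub, matAct_mul, matAct_mul, sub_eq_iff_eq_add, ← map_add,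
    funext_iff]
  refine forall_congr' fun a => ?_
  rw [Model.opDen, Model.opNum, matAct_diagonal, matAct_diagonal, map_denOp, map_numOp,
    Pi.add_apply, matAct_map, matAct_map, add_comm]

/-- Elimination of the state subvectors other than the first one, for invertible isometries in a
commutative Banach algebra of operators in place of the points of the unit circle. -/
theorem Model.WellPosed.exists_operator_of_algebra (hS : S.WellPosed) {A : Type*}
    [NormedCommRing A] [NormedAlgebra ℂ A] [CompleteSpace A] (ι : A →ₐ[ℂ] (H →L[ℂ] H))
    (hι : Continuous ι) (h1 : ‖(1 : A)‖ ≤ 1) (u u' : Fin m → A) (hu : ∀ i, ‖u i‖ ≤ 1)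
    (hu' : ∀ i, ‖u' i‖ ≤ 1) (huu' : ∀ i, u i * u' i = 1) (U : Fin m → H →L[ℂ] H)
    (hU : ∀ i, ι (u i) = U i) :
    ∃ (G : (Fin (S.k 0) → H) →L[ℂ] (S.Rest → H))
      (N : (Fin (S.k 0) → H) →L[ℂ] (Fin (S.k 0) → H)),
      (∀ X Y, (∀ a : S.Rest, denOp (S.qs a.1) (U a.1) (Y a) = numOp (S.qs a.1) (U a.1)
        (∑ b, S.AM a b • Y b + ∑ b, S.BM a b • X b)) ↔ Y = G X) ∧
      (∀ X a, N X a = ∑ b, S.DM a b • X b + ∑ b, S.CM a b • G X b) ∧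
      ((∀ δ ∈ S.boundary, ∀ (z : ℂ) (v : Fin (S.k 0) → ℂ), v ≠ 0 → S.M δ *ᵥ v = z • v →
        InRegion (S.q 0) z) →
        Tendsto (fun n : ℕ => ‖stepOp (S.q 0) N ^ n‖) atTop (𝓝 0)) ∧
      (∀ δ ∈ S.boundary, ∃ u : Fin m → ℂ, (∀ i, ‖u i‖ = 1) ∧
        ∀ w : ℕ → H, (∀ i, ApproxEigen w (U i) (u i)) → ∀ (z : ℂ) (v : Fin (S.k 0) → ℂ),
          S.M δ *ᵥ v = z • v →
          Tendsto (fun n => N (fun a => v a • w n) - z • fun a => v a • w n) atTop (𝓝 0)) := by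
  obtain rfl : (fun i => ι (u i)) = U := funext hU
  have hdet : IsUnit (S.opPencil u).det := hS.isUnit_det_opPencil h1 hu hu' huu'
  refine ⟨matAct ι (S.opG u), matActHom ι _ (S.opM u), fun X Y => ?_, fun X a => ?_,
    fun hM => hS.tendsto_norm_stepOp_pow h1 hu hu' huu' hM (matActHom ι _)
      (continuous_matActHom ι hι _), fun δ hδ => ?_⟩
  · rw [Model.matAct_opPencil_eq_iff]
    constructor
    · intro h3
      rw [Model.opG, matAct_mul, ← h3, ← matAct_mul, Matrix.nonsing_inv_mul _ hdet, matAct_one]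
    · rintro rfl
      rw [← matAct_mul, Model.opG, ← Matrix.mul_assoc, Matrix.mul_nonsing_inv _ hdet, Matrix.one_mul]
  · change matAct ι (S.opM u) X a = _
    rw [Model.opM, matAct_add, matAct_mul, Pi.add_apply, matAct_map, matAct_map]
  · obtain ⟨c, hc, hcdet, hcM⟩ := hS.exists_circle hδ
    refine ⟨c, hc, fun w hw z v hv => ?_⟩
    have h3 : ApproxMat ι w (S.opM u) (S.opM c) := Model.approxMat_opM hdet hcdet hw
    have h4 := h3.tendsto_matAct v
    rw [hcM, hv] at h4
    refine h4.congr fun n => ?_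
    congr 1
    ext1 a
    simp [smul_smul]

/-- Elimination of the state subvectors other than the first one, for commuting invertible
isometries in place of the points of the unit circle. -/
theorem Model.WellPosed.exists_operator (hS : S.WellPosed) (U U' : Fin m → H →L[ℂ] H)
    (hU : ∀ i, ‖U i‖ ≤ 1) (hU' : ∀ i, ‖U' i‖ ≤ 1) (hUU' : ∀ i, U i * U' i = 1)
    (hU'U : ∀ i, U' i * U i = 1) (hcomm : ∀ i j, U i * U j = U j * U i) :
    ∃ (G : (Fin (S.k 0) → H) →L[ℂ] (S.Rest → H))
      (N : (Fin (S.k 0) → H) →L[ℂ] (Fin (S.k 0) → H)),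
      (∀ X Y, (∀ a : S.Rest, denOp (S.qs a.1) (U a.1) (Y a) = numOp (S.qs a.1) (U a.1)
        (∑ b, S.AM a b • Y b + ∑ b, S.BM a b • X b)) ↔ Y = G X) ∧
      (∀ X a, N X a = ∑ b, S.DM a b • X b + ∑ b, S.CM a b • G X b) ∧
      ((∀ δ ∈ S.boundary, ∀ (z : ℂ) (v : Fin (S.k 0) → ℂ), v ≠ 0 → S.M δ *ᵥ v = z • v →
        InRegion (S.q 0) z) →
        Tendsto (fun n : ℕ => ‖stepOp (S.q 0) N ^ n‖) atTop (𝓝 0)) ∧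
      (∀ δ ∈ S.boundary, ∃ u : Fin m → ℂ, (∀ i, ‖u i‖ = 1) ∧
        ∀ w : ℕ → H, (∀ i, ApproxEigen w (U i) (u i)) → ∀ (z : ℂ) (v : Fin (S.k 0) → ℂ),
          S.M δ *ᵥ v = z • v →
          Tendsto (fun n => N (fun a => v a • w n) - z • fun a => v a • w n) atTop (𝓝 0)) := by
  have hc1 : ∀ i j, U i * U' j = U' j * U i := fun i j => by
    calc U i * U' j = U' j * U j * (U i * U' j) := by rw [hU'U, one_mul]
      _ = U' j * (U j * U i) * U' j := by simp only [mul_assoc]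
      _ = U' j * U i * (U j * U' j) := by rw [hcomm]; simp only [mul_assoc]
      _ = U' j * U i := by rw [hUU', mul_one]
  have hc2 : ∀ i j, U' i * U' j = U' j * U' i := fun i j => by
    calc U' i * U' j = U' i * U' j * (U i * U' i) := by rw [hUU', mul_one]
      _ = U' i * (U' j * U i) * U' i := by simp only [mul_assoc]
      _ = U' i * U i * (U' j * U' i) := by rw [← hc1]; simp only [mul_assoc]
      _ = U' j * U' i := by rw [hU'U, one_mul]
  -- The inverses are adjoined too, so that characters of the algebra have modulus 1 on the `U i`;
  -- closedness provides the completeness that Gelfand theory requires.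
  obtain ⟨𝒜, hs, hcl, hmul⟩ := exists_commutative_algebra (Set.range U ∪ Set.range U') (by
    rintro _ (⟨i, rfl⟩ | ⟨i, rfl⟩) _ (⟨j, rfl⟩ | ⟨j, rfl⟩)
    exacts [hcomm i j, hc1 i j, (hc1 j i).symm, hc2 i j])
  let _ : NormedCommRing 𝒜 := { (inferInstance : NormedRing 𝒜) with mul_comm := hmul }
  let _ : NormedAlgebra ℂ 𝒜 := { (inferInstance : Algebra ℂ 𝒜) with
    norm_smul_le := fun c a => norm_smul_le c (a : H →L[ℂ] H) }
  have hcs : CompleteSpace 𝒜 := hcl.completeSpace_coe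
  exact hS.exists_operator_of_algebra 𝒜.val continuous_subtype_val ContinuousLinearMap.norm_id_le
    (fun i => ⟨U i, hs (Or.inl ⟨i, rfl⟩)⟩) (fun i => ⟨U' i, hs (Or.inr ⟨i, rfl⟩)⟩) hU hU'
    (fun i => Subtype.ext (hUU' i)) U fun i => rfl

end Operator

/-! ### Evolution in time -/

/-- The value at time `t` of the solution of the scalar equation `q x = z x`, `x 0 = 1`. -/
def scalarFlow : ∀ q, ℂ → Axis q → ℂ
  | .derivative => fun z => fun t : ℝ => Complex.exp (t * z)
  | .shift => fun z => fun t : ℤ => z ^ t.toNat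

/-- Contraction at one single time is enough: the modulus is `e ^ (t Re z)` or a power of `|z|`, and
`t = 0` would give modulus 1. -/
theorem inRegion_of_norm_scalarFlow_lt_one {q : Propagation} {z : ℂ} {t : Axis q} (ht : 0 ≤ t)
    (h : ‖scalarFlow q z t‖ < 1) : InRegion q z := by
  cases q with
  | derivative =>
    revert t
    intro (t : ℝ) (ht : 0 ≤ t) (h : ‖Complex.exp (t * z)‖ < 1)
    rw [Complex.norm_exp, Real.exp_lt_one_iff, Complex.re_ofReal_mul] at h
    exact (neg_of_mul_neg_right h ht :)
  | shift =>
    revert t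
    intro (t : ℤ) _ (h : ‖z ^ t.toNat‖ < 1)
    rw [norm_pow] at h
    change ‖z‖ < 1
    by_contra h1
    exact absurd h (not_lt.2 (one_le_pow₀ (not_lt.1 h1)))

section Evolution

theorem AdvancesTo.map {E F : Type*} [NormedAddCommGroup E] [NormedSpace ℝ E]
    [NormedAddCommGroup F] [NormedSpace ℝ F] {q : Propagation} {s : Set (Axis q)} {x : Axis q → E}
    {t : Axis q} {v : E} (L : E →L[ℝ] F) (h : AdvancesTo q s x t v) :
    AdvancesTo q s (fun t => L (x t)) t (L v) := by
  cases q with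
  | derivative =>
    revert t
    intro (t : ℝ) h
    exact L.hasFDerivAt.comp_hasDerivWithinAt t h
  | shift => exact congrArg L h

theorem AdvancesTo.sum {E α : Type*} [NormedAddCommGroup E] [NormedSpace ℝ E] {q : Propagation}
    {s : Set (Axis q)} {c : Finset α} {x : α → Axis q → E} {t : Axis q} {v : α → E}
    (h : ∀ a ∈ c, AdvancesTo q s (x a) t (v a)) :
    AdvancesTo q s (fun t => ∑ a ∈ c, x a t) t (∑ a ∈ c, v a) := by
  cases q with
  | derivative => exact HasDerivWithinAt.fun_sum h
  | shift => exact Finset.sum_congr rfl h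

variable {F : Type*} [NormedAddCommGroup F] [NormedSpace ℂ F]

/-- `x` solves `q x = N x` for nonnegative times. -/
def Evolves (q : Propagation) (N : F →L[ℂ] F) (x : Axis q → F) : Prop :=
  ∀ t, 0 ≤ t → AdvancesTo q (Set.Ici 0) x t (N (x t))

theorem hasDerivAt_exp_smul_apply [CompleteSpace F] (N : F →L[ℂ] F) (f : F) (t : ℝ) :
    HasDerivAt (fun t : ℝ => NormedSpace.exp (t • N) f) (N (NormedSpace.exp (t • N) f)) t := by
  have h := hasDerivAt_exp_smul_const' (𝕂 := ℝ) N t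
  have h2 := ((ContinuousLinearMap.apply ℂ F f).restrictScalars ℝ).hasFDerivAt.comp_hasDerivAt t h
  exact h2

theorem evolves_derivative_iff [CompleteSpace F] {N : F →L[ℂ] F} {x : ℝ → F}
    (h : Evolves .derivative N x) {t : ℝ} (ht : 0 ≤ t) : x t = NormedSpace.exp (t • N) (x 0) := by
  have h1 : ∀ s ∈ Set.Ico 0 t, HasDerivWithinAt x (N (x s)) (Set.Ici s) s := fun s hs =>
    (h s hs.1 : HasDerivWithinAt x _ (Set.Ici 0) s).mono (Set.Ici_subset_Ici.2 hs.1)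
  have h2 : ContinuousOn x (Set.Icc 0 t) := fun s hs =>
    ((h s hs.1 : HasDerivWithinAt x _ (Set.Ici 0) s).continuousWithinAt).mono
      Set.Icc_subset_Ici_self
  have h3 := fun s => hasDerivAt_exp_smul_apply N (x 0) s
  exact ODE_solution_unique (v := fun _ => N) (K := ‖N‖₊) (fun _ => N.lipschitz) h2 h1
    (fun s _ => (h3 s).continuousAt.continuousWithinAt)
    (fun s _ => (h3 s).hasDerivWithinAt) (by simp) (Set.right_mem_Icc.2 ht)

theorem evolves_shift_iff {N : F →L[ℂ] F} {x : ℤ → F} (h : Evolves .shift N x) (n : ℕ) :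
    x n = (N ^ n) (x 0) := by
  induction n with
  | zero => simp
  | succ n ih =>
    have h1 : x ((n : ℤ) + 1) = N (x n) := h (n : ℤ) (Int.natCast_nonneg n)
    rw [Nat.cast_succ, h1, ih, pow_succ']
    rfl

/-- Uniform asymptotic stability of an evolution whose steps have powers that tend to zero. -/
theorem exists_decay [CompleteSpace F] (q : Propagation) (N : F →L[ℂ] F)
    (h : Tendsto (fun n : ℕ => ‖stepOp q N ^ n‖) atTop (𝓝 0)) :
    (∃ C : ℝ, 0 < C ∧ ∀ x, Evolves q N x → ∀ t, 0 ≤ t → ‖x t‖ ≤ C * ‖x 0‖) ∧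
    ∀ ε : ℝ, 0 < ε → ∃ T : Axis q, 0 ≤ T ∧ ∀ x, Evolves q N x → ∀ t, T ≤ t →
      ‖x t‖ ≤ ε * ‖x 0‖ := by
  obtain ⟨C, hC⟩ := h.bddAbove_range
  have hC' : ∀ n, ‖stepOp q N ^ n‖ ≤ C := fun n => hC ⟨n, rfl⟩
  have hC0 : 0 ≤ C := (norm_nonneg _).trans (hC' 0)
  cases q with
  | shift =>
    have key : ∀ x, Evolves .shift N x → ∀ t : ℤ, 0 ≤ t → ∃ n : ℕ, (n : ℤ) = t ∧
        ‖x t‖ ≤ ‖N ^ n‖ * ‖x 0‖ := by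
      intro x hx t ht
      obtain ⟨n, rfl⟩ := Int.eq_ofNat_of_zero_le ht
      refine ⟨n, rfl, ?_⟩
      rw [evolves_shift_iff hx n]
      exact ContinuousLinearMap.le_opNorm _ _
    refine ⟨⟨C + 1, by linarith, fun x hx t ht => ?_⟩, fun ε hε => ?_⟩
    · obtain ⟨n, -, hn⟩ := key x hx t ht
      refine hn.trans (mul_le_mul_of_nonneg_right ?_ (norm_nonneg _))
      have : ‖N ^ n‖ ≤ C := hC' n
      linarith
    · obtain ⟨n₀, hn₀⟩ := eventually_atTop.1 (h.eventually (ge_mem_nhds hε))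
      refine ⟨(n₀ : ℤ), Int.natCast_nonneg n₀, fun x hx t ht => ?_⟩
      have ht' : (n₀ : ℤ) ≤ t := ht
      obtain ⟨n, hn, hn'⟩ := key x hx t ((Int.natCast_nonneg n₀).trans ht')
      refine hn'.trans (mul_le_mul_of_nonneg_right (hn₀ n ?_) (norm_nonneg _))
      have hn2 : (n : ℤ) = (t : ℤ) := hn
      rw [← hn2] at ht'
      exact_mod_cast ht'
  | derivative =>
    -- `D` bounds the flow over the fractional part of the time; the integer part is a power of the
    -- unit-time step.
    obtain ⟨D, hD1, hD⟩ : ∃ D : ℝ, 1 ≤ D ∧ ∀ s ∈ Set.Icc (0 : ℝ) 1,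
        ‖NormedSpace.exp (s • N)‖ ≤ D := by
      have hc : Continuous fun s : ℝ => NormedSpace.exp (s • N) :=
        continuous_iff_continuousAt.2 fun s =>
          (hasDerivAt_exp_smul_const (𝕂 := ℝ) N s).continuousAt
      obtain ⟨D, hD⟩ := isCompact_Icc.exists_bound_of_continuousOn (s := Set.Icc (0 : ℝ) 1)
        hc.continuousOn
      exact ⟨max 1 D, le_max_left _ _, fun s hs => (hD s hs).trans (le_max_right _ _)⟩
    have key : ∀ x, Evolves .derivative N x → ∀ t : ℝ, 0 ≤ t →
        ‖x t‖ ≤ D * ‖NormedSpace.exp N ^ ⌊t⌋₊‖ * ‖x 0‖ := by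
      intro x hx t ht
      let _ := NormedAlgebra.restrictScalars ℚ ℂ (F →L[ℂ] F)
      have h1 : NormedSpace.exp (t • N) =
          NormedSpace.exp ((t - ⌊t⌋₊) • N) * NormedSpace.exp N ^ ⌊t⌋₊ := by
        rw [← NormedSpace.exp_nsmul, ← NormedSpace.exp_add_of_commute]
        · rw [← Nat.cast_smul_eq_nsmul ℝ, ← add_smul, sub_add_cancel]
        · exact ((Commute.refl N).smul_left _).smul_right _
      rw [evolves_derivative_iff hx ht, h1]
      refine (ContinuousLinearMap.le_opNorm _ _).trans
        (mul_le_mul_of_nonneg_right ((norm_mul_le _ _).trans ?_) (norm_nonneg _))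
      refine mul_le_mul_of_nonneg_right (hD _ ⟨?_, ?_⟩) (norm_nonneg _)
      · exact sub_nonneg.2 (Nat.floor_le ht)
      · linarith [Nat.lt_floor_add_one t]
    have keyC : ∀ x, Evolves .derivative N x → ∀ t : ℝ, 0 ≤ t → ‖x t‖ ≤ (D * C + 1) * ‖x 0‖ := by
      intro x hx t ht
      refine (key x hx t ht).trans (mul_le_mul_of_nonneg_right ?_ (norm_nonneg _))
      have h2 : ‖NormedSpace.exp N ^ ⌊t⌋₊‖ ≤ C := hC' _
      nlinarith
    refine ⟨⟨D * C + 1, by positivity, keyC⟩, fun ε hε => ?_⟩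
    obtain ⟨n₀, hn₀⟩ := eventually_atTop.1
      (h.eventually (ge_mem_nhds (show 0 < ε / D by positivity)))
    have keyT : ∀ x, Evolves .derivative N x → ∀ t : ℝ, (n₀ : ℝ) ≤ t → ‖x t‖ ≤ ε * ‖x 0‖ := by
      intro x hx t ht
      refine (key x hx t ((Nat.cast_nonneg n₀).trans ht)).trans
        (mul_le_mul_of_nonneg_right ?_ (norm_nonneg _))
      have h2 : ‖NormedSpace.exp N ^ ⌊t⌋₊‖ ≤ ε / D := hn₀ _ (Nat.le_floor ht)
      rw [le_div_iff₀ (by linarith)] at h2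
      linarith
    exact ⟨(n₀ : ℝ), (Nat.cast_nonneg n₀ : (0 : ℝ) ≤ n₀), keyT⟩

/-- Every initial value is the start of a solution, and approximate eigenvectors evolve as scalar
multiples up to a small error. -/
theorem exists_evolves [CompleteSpace F] (q : Propagation) (N : F →L[ℂ] F) :
    ∃ Φ : Axis q → F →L[ℂ] F, Φ 0 = 1 ∧ (∀ f, Evolves q N fun t => Φ t f) ∧
      ∀ (t : Axis q) (z : ℂ), ∃ K : F →L[ℂ] F, ∀ f,
        Φ t f - scalarFlow q z t • f = K (N f - z • f) := by
  cases q with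
  | derivative =>
    let _ := NormedAlgebra.restrictScalars ℚ ℂ (F →L[ℂ] F)
    refine ⟨fun t : ℝ => NormedSpace.exp (t • N), ?_, fun f t _ => ?_, ?_⟩
    · change NormedSpace.exp ((0 : ℝ) • N) = 1
      rw [zero_smul, NormedSpace.exp_zero]
    · exact (hasDerivAt_exp_smul_apply N f t).hasDerivWithinAt
    · intro (t : ℝ) z
      -- The factorization produces `t • N - t z`; its scalar factor `t` is moved into the operator.
      obtain ⟨K, hK⟩ := exists_exp_sub_algebraMap_eq_mul (t • N) (t * z)
      refine ⟨t • K, fun f => ?_⟩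
      have h1 := congrArg (fun T : F →L[ℂ] F => T f) hK
      simp only [Algebra.algebraMap_eq_smul_one, _root_.sub_apply, mul_apply_eq_comp,
        _root_.smul_apply, one_apply_eq_self] at h1
      refine Eq.trans h1 ?_
      rw [← smul_smul, Complex.coe_smul, ← smul_sub]
      exact K.map_smul_of_tower t _
  | shift =>
    refine ⟨fun t : ℤ => N ^ t.toNat, ?_, ?_, ?_⟩
    · change N ^ (0 : ℤ).toNat = 1
      rw [Int.toNat_zero, pow_zero]
    · intro f (t : ℤ) (ht : 0 ≤ t)
      change (N ^ (t + 1).toNat) f = N ((N ^ t.toNat) f)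
      rw [Int.toNat_add ht zero_le_one, Int.toNat_one, pow_succ']
      rfl
    · intro (t : ℤ) z
      -- `N - z` divides `N ^ n - z ^ n`, the cofactor being a geometric sum.
      obtain ⟨K, hK⟩ : ∃ K, N ^ t.toNat - algebraMap ℂ (F →L[ℂ] F) z ^ t.toNat =
          K * (N - algebraMap ℂ (F →L[ℂ] F) z) :=
        ⟨_, ((Algebra.commute_algebraMap_right z N).geom_sum₂_mul _).symm⟩
      refine ⟨K, fun f => ?_⟩
      have h1 := congrArg (fun T : F →L[ℂ] F => T f) hK
      rw [← map_pow] at h1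
      simp only [Algebra.algebraMap_eq_smul_one, _root_.sub_apply, mul_apply_eq_comp,
        _root_.smul_apply, one_apply_eq_self] at h1
      exact h1

end Evolution

end Operators

section Flows

/-! ### Strongly continuous groups of isometries -/

/-- A strongly continuous one-parameter group of isometries. -/
structure IsIsometricFlow {H : Type*} [NormedAddCommGroup H] [NormedSpace ℂ H]
    (τ : ℝ → H →L[ℂ] H) : Prop where
  zero : τ 0 = 1
  add : ∀ s t, τ (s + t) = τ s * τ t
  norm : ∀ s x, ‖τ s x‖ = ‖x‖
  cont : ∀ x, Continuous fun s => τ s x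

namespace IsIsometricFlow

variable {H : Type*} [NormedAddCommGroup H] [InnerProductSpace ℂ H] {τ : ℝ → H →L[ℂ] H}

theorem neg (h : IsIsometricFlow τ) : IsIsometricFlow fun s => τ (-s) where
  zero := by rw [neg_zero, h.zero]
  add s t := by rw [neg_add, h.add]
  norm s x := h.norm _ x
  cont x := (h.cont x).comp continuous_neg

theorem hasDerivAt_neg_iff {x y : H} :
    HasDerivAt (fun s => τ (-s) x) y 0 ↔ HasDerivAt (fun s => τ s x) (-y) 0 := by
  have key : ∀ (f : ℝ → H) (z : H), HasDerivAt f z 0 → HasDerivAt (fun s => f (-s)) (-z) 0 := by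
    intro f z hf
    rw [← neg_zero] at hf
    simpa [Function.comp_def] using hf.scomp (0 : ℝ) (hasDerivAt_neg (0 : ℝ))
  constructor
  · intro hx
    simpa using key _ _ hx
  · intro hx
    simpa using key _ _ hx

/-- The generator is skew. -/
theorem re_inner_eq_zero (h : IsIsometricFlow τ) {x y : H}
    (hx : HasDerivAt (fun s => τ s x) y 0) : (inner ℂ x y).re = 0 := by
  have h1 := hx.inner ℂ hx
  -- The squared norm is constant along the flow, so its derivative `2 Re ⟨x, y⟩` vanishes.
  have h2 : (fun s => inner ℂ (τ s x) (τ s x)) = fun _ => ((‖x‖ : ℂ)) ^ 2 := by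
    ext s
    rw [inner_self_eq_norm_sq_to_K, h.norm]
    rfl
  rw [h2, h.zero] at h1
  have h3 := h1.unique (hasDerivAt_const (0 : ℝ) _)
  have h4 := congrArg Complex.re h3
  rw [Complex.add_re, ← inner_conj_symm y, Complex.conj_re] at h4
  simp only [one_apply_eq_self, Complex.zero_re] at h4
  linarith

/-- Skewness makes this Pythagoras. With `y = D x` it bounds `1 - D` from below, which gives
injectivity and a contractive resolvent. -/
theorem norm_sub_sq (h : IsIsometricFlow τ) {x y : H} (hx : HasDerivAt (fun s => τ s x) y 0) :
    ‖x - y‖ ^ 2 = ‖x‖ ^ 2 + ‖y‖ ^ 2 := by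
  have h1 := h.re_inner_eq_zero hx
  have h2 := _root_.norm_sub_sq (𝕜 := ℂ) x y
  simp only [RCLike.re_to_complex] at h2
  rw [h2, h1]
  ring

/-- This is why the Cayley transform, sending `x - D x` to `x + D x`, is isometric. -/
theorem norm_add_eq_norm_sub (h : IsIsometricFlow τ) {x y : H}
    (hx : HasDerivAt (fun s => τ s x) y 0) : ‖x + y‖ = ‖x - y‖ := by
  have h1 := h.re_inner_eq_zero hx
  have h2 := norm_add_sq (𝕜 := ℂ) x y
  simp only [RCLike.re_to_complex] at h2
  rw [← sq_eq_sq₀ (norm_nonneg _) (norm_nonneg _), h.norm_sub_sq hx, h2, h1]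
  ring

theorem integrable (h : IsIsometricFlow τ) (f : H) (a : ℝ) :
    IntegrableOn (fun s : ℝ => Real.exp (-s) • τ s f) (Set.Ioi a) := by
  have h1 : IntegrableOn (fun s : ℝ => Real.exp (-s) * ‖f‖) (Set.Ioi a) := by
    have := (integrableOn_exp_mul_Ioi (a := -1) (by norm_num) a).mul_const ‖f‖
    simpa [IntegrableOn] using this
  refine Integrable.mono' h1 ?_ (Eventually.of_forall fun s => ?_)
  · exact ((Real.continuous_exp.comp continuous_neg).smul (h.cont f)).aestronglyMeasurable
  · rw [norm_smul, h.norm, Real.norm_of_nonneg (Real.exp_pos _).le]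

variable [CompleteSpace H]

/-- Write `J f` for the Laplace transform of the orbit at 1. Substitution gives `τ t (J f) = e ^ t
(J f - ∫₀ᵗ e ^ (-s) τ s f)`, and differentiation at 0 yields `D (J f) = J f - f`, that is `(1 - D) J
f = f`. -/
theorem hasDerivAt_resolvent (h : IsIsometricFlow τ) (f : H) :
    HasDerivAt (fun s => τ s (∫ s in Set.Ioi (0 : ℝ), Real.exp (-s) • τ s f))
      ((∫ s in Set.Ioi (0 : ℝ), Real.exp (-s) • τ s f) - f) 0 := by
  set φ : ℝ → H := fun s => Real.exp (-s) • τ s f with hφ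
  have hφc : Continuous φ := (Real.continuous_exp.comp continuous_neg).smul (h.cont f)
  have h1 : ∀ t, τ t (∫ s in Set.Ioi (0 : ℝ), φ s) =
      Real.exp t • ((∫ s in Set.Ioi (0 : ℝ), φ s) - ∫ s in (0 : ℝ)..t, φ s) := by
    intro t
    rw [← intervalIntegral.integral_Ioi_sub_Ioi' (h.integrable f 0) (h.integrable f t),
      sub_sub_cancel, ← ContinuousLinearMap.integral_comp_comm _ (h.integrable f 0),
      ← (measurePreserving_add_right volume t).setIntegral_preimage_emb
        (measurableEmbedding_addRight t) φ (Set.Ioi t), ← integral_smul]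
    have hpre : (fun x : ℝ => x + t) ⁻¹' Set.Ioi t = Set.Ioi 0 := by
      ext x
      simp
    rw [hpre]
    congr 1
    ext s
    rw [hφ]
    simp only
    rw [ContinuousLinearMap.map_smul_of_tower, smul_smul, ← Real.exp_add, add_comm s t, h.add]
    simp
  rw [funext h1]
  have h2 : HasDerivAt (fun t => ∫ s in (0 : ℝ)..t, φ s) (φ 0) 0 :=
    intervalIntegral.integral_hasDerivAt_right (hφc.intervalIntegrable _ _)
      (hφc.stronglyMeasurableAtFilter _ _) hφc.continuousAt
  have h3 := (Real.hasDerivAt_exp 0).smul (h2.const_sub (∫ s in Set.Ioi (0 : ℝ), φ s))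
  convert! h3 using 1
  simp [hφ, h.zero]
  abel

-- The difference `x - x'` is annihilated by `1 - D`, so Pythagoras makes it zero.
omit [CompleteSpace H] in
theorem eq_of_hasDerivAt (h : IsIsometricFlow τ) {x y x' y' : H}
    (hx : HasDerivAt (fun s => τ s x) y 0) (hx' : HasDerivAt (fun s => τ s x') y' 0)
    (he : x - y = x' - y') : x = x' := by
  have h1 : HasDerivAt (fun s => τ s (x - x')) (y - y') 0 := by
    simpa [Pi.sub_def] using hx.sub hx'
  have h2 := h.norm_sub_sq h1
  rw [show x - x' - (y - y') = (x - y) - (x' - y') by abel, he, sub_self, norm_zero] at h2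
  have h3 : ‖x - x'‖ = 0 := by
    nlinarith [norm_nonneg (x - x'), norm_nonneg (y - y')]
  exact sub_eq_zero.1 (norm_eq_zero.1 h3)

/-- The resolvent `(1 - D)⁻¹` of the generator `D`. -/
theorem exists_resolvent (h : IsIsometricFlow τ) :
    ∃ J : H →L[ℂ] H, (∀ f, J f = ∫ s in Set.Ioi (0 : ℝ), Real.exp (-s) • τ s f) ∧
      ∀ x y, HasDerivAt (fun s => τ s x) y 0 ↔ J (x - y) = x := by
  let J₀ : H →ₗ[ℂ] H :=
    { toFun := fun f => ∫ s in Set.Ioi (0 : ℝ), Real.exp (-s) • τ s f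
      map_add' := fun f g => by
        rw [← integral_add (h.integrable f 0) (h.integrable g 0)]
        simp
      map_smul' := fun c f => by
        rw [RingHom.id_apply, ← integral_smul]
        congr 1
        ext s
        rw [map_smul, smul_comm] }
  have hJ₀ : ∀ f, HasDerivAt (fun s => τ s (J₀ f)) (J₀ f - f) 0 := h.hasDerivAt_resolvent
  -- The bound 1 comes from `‖f‖² = ‖J f‖² + ‖J f - f‖²`.
  let J : H →L[ℂ] H := J₀.mkContinuous 1 fun f => by
    have h1 := h.norm_sub_sq (hJ₀ f)
    rw [sub_sub_cancel] at h1
    nlinarith [norm_nonneg f, norm_nonneg (J₀ f), sq_nonneg ‖J₀ f - f‖]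
  refine ⟨J, fun f => rfl, fun x y => ⟨fun hx => ?_, fun hx => ?_⟩⟩
  · refine (h.eq_of_hasDerivAt hx (hJ₀ (x - y)) ?_).symm
    rw [sub_sub_cancel]
  · have h1 := hJ₀ (x - y)
    have h2 : J₀ (x - y) = x := hx
    rwa [h2, sub_sub_cancel] at h1

/-- `1 / (1 - iω)` is the Laplace transform of `e ^ (iωs)` at 1, so the difference is the transform
of the error, and the weight `e ^ (-s)` tolerates its linear growth. -/
theorem norm_resolvent_sub_le {J : H →L[ℂ] H} (h : IsIsometricFlow τ)
    (hJ : ∀ f, J f = ∫ s in Set.Ioi (0 : ℝ), Real.exp (-s) • τ s f) (w : H) (ω ε : ℝ)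
    (hw : ∀ s : ℝ, 0 ≤ s → ‖τ s w - Complex.exp (ω * s * Complex.I) • w‖ ≤ ε * (1 + s)) :
    ‖J w - (1 / (1 - ω * Complex.I)) • w‖ ≤ 4 * ε := by
  have hre : (-(1 - ω * Complex.I)).re < 0 := by simp
  have h1 := integral_exp_mul_complex_Ioi hre 0
  have h1i := integrableOn_exp_mul_complex_Ioi hre 0
  have h2 : (1 / (1 - ω * Complex.I)) • w =
      ∫ s in Set.Ioi (0 : ℝ), Complex.exp (-(1 - ω * Complex.I) * s) • w := by
    rw [integral_smul_const, h1, neg_div_neg_eq, Complex.ofReal_zero, mul_zero, Complex.exp_zero]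
  rw [hJ, h2, ← integral_sub (h.integrable w 0) (h1i.smul_const w)]
  have h3 : ∀ s : ℝ, Real.exp (-s) • τ s w - Complex.exp (-(1 - ω * Complex.I) * s) • w =
      Real.exp (-s) • (τ s w - Complex.exp (ω * s * Complex.I) • w) := by
    intro s
    rw [smul_sub, ← Complex.coe_smul (Real.exp (-s)) (Complex.exp _ • w), smul_smul,
      Complex.ofReal_exp, ← Complex.exp_add]
    congr 3
    push_cast
    ring
  have hε : 0 ≤ ε := by simpa using (norm_nonneg _).trans (hw 0 le_rfl)
  have hi := integrableOn_exp_mul_Ioi (a := -(1 / 2)) (by norm_num) 0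
  have h4 : ∫ s in Set.Ioi (0 : ℝ), 2 * ε * Real.exp (-(1 / 2) * s) = 4 * ε := by
    rw [integral_const_mul, integral_exp_mul_Ioi (by norm_num)]
    norm_num
    ring
  rw [← h4]
  refine norm_integral_le_of_norm_le (hi.const_mul _) ?_
  refine (ae_restrict_iff' measurableSet_Ioi).2 (Eventually.of_forall fun s hs => ?_)
  have hs' : 0 < s := hs
  rw [h3, norm_smul, Real.norm_of_nonneg (Real.exp_pos _).le]
  -- Half of the decay absorbs `1 + s ≤ 2 e ^ (s / 2)`; the integral of the other half is 2, whence
  -- the constant 4.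
  have h5 : Real.exp (-s) = Real.exp (-(1 / 2) * s) * Real.exp (-(1 / 2) * s) := by
    rw [← Real.exp_add]
    ring_nf
  have h6 : 1 + s / 2 ≤ Real.exp (1 / 2 * s) := by
    have := Real.add_one_le_exp (1 / 2 * s)
    linarith
  have h7 : Real.exp (-(1 / 2) * s) * Real.exp (1 / 2 * s) = 1 := by
    rw [← Real.exp_add]
    ring_nf
    exact Real.exp_zero
  have h8 := Real.exp_pos (-(1 / 2) * s)
  calc Real.exp (-s) * ‖τ s w - Complex.exp (ω * s * Complex.I) • w‖
      ≤ Real.exp (-s) * (ε * (1 + s)) := by gcongr; exact hw s hs'.le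
    _ ≤ Real.exp (-(1 / 2) * s) * Real.exp (-(1 / 2) * s) *
          (ε * (2 * Real.exp (1 / 2 * s))) := by
        rw [h5]
        gcongr
        linarith
    _ = 2 * ε * Real.exp (-(1 / 2) * s) *
          (Real.exp (-(1 / 2) * s) * Real.exp (1 / 2 * s)) := by ring
    _ = 2 * ε * Real.exp (-(1 / 2) * s) := by rw [h7, mul_one]

end IsIsometricFlow

/-- Points of the closed unit circle with center and radius `1 / 2` are limits of points
`1 / (1 - ω i)`. -/
theorem exists_frequency {u : ℂ} (hu : ‖u‖ = 1) :
    ∃ ω : ℕ → ℝ, Tendsto (fun n => 1 / (1 - ω n * Complex.I)) atTop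
      (𝓝 ((1 / 2 : ℂ) * (u + 1))) := by
  -- `u = -1` belongs to infinite frequency and is only a limit. Any other `u` is attained by the
  -- constant sequence with `iω = (u - 1) / (u + 1)`.
  by_cases h1 : u + 1 = 0
  · refine ⟨fun n => n, ?_⟩
    rw [h1, mul_zero]
    refine squeeze_zero_norm' ?_ (tendsto_one_div_atTop_nhds_zero_nat (𝕜 := ℝ))
    filter_upwards [eventually_gt_atTop 0] with n hn
    have hn' : (0 : ℝ) < n := by exact_mod_cast hn
    rw [norm_div, norm_one]
    refine one_div_le_one_div_of_le hn' ?_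
    have := Complex.abs_im_le_norm (1 - ((n : ℝ) : ℂ) * Complex.I)
    simpa using this
  · refine ⟨fun _ => ((u - 1) / (u + 1) * -Complex.I).re, ?_⟩
    refine tendsto_const_nhds.congr fun n => ?_
    have h2 : Complex.normSq u = 1 := by rw [Complex.normSq_eq_norm_sq, hu, one_pow]
    rw [Complex.normSq_apply] at h2
    have h3 : (((u - 1) / (u + 1)).re) = 0 := by
      rw [Complex.div_re, ← add_div, div_eq_zero_iff]
      left
      simp
      linarith
    have h4 : ((((u - 1) / (u + 1) * -Complex.I).re : ℝ) : ℂ) * Complex.I = (u - 1) / (u + 1) := by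
      apply Complex.ext <;> simp [h3]
    rw [h4]
    have h5 : 1 - (u - 1) / (u + 1) = 2 / (u + 1) := by
      field_simp
      ring
    rw [h5]
    field_simp

/-! ### The operator attached to an axis -/

instance : ∀ q, TopologicalSpace (Axis q)
  | .derivative => inferInstanceAs (TopologicalSpace ℝ)
  | .shift => inferInstanceAs (TopologicalSpace ℤ)

/-- The absolute value on an axis. -/
def axisAbs : ∀ q, Axis q → ℝ
  | .derivative => fun s : ℝ => |s|
  | .shift => fun s : ℤ => |(s : ℝ)|

theorem axisAbs_nonneg (q : Propagation) (s : Axis q) : 0 ≤ axisAbs q s := by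
  revert s
  cases q with
  | derivative => exact fun s : ℝ => abs_nonneg s
  | shift => exact fun s : ℤ => abs_nonneg (s : ℝ)

/-- `χ` is a measurable character of an axis. -/
structure IsAxisCharacter {q : Propagation} (χ : Axis q → ℂ) : Prop where
  add : ∀ s t, χ (s + t) = χ s * χ t
  norm : ∀ s, ‖χ s‖ = 1
  measurable : Measurable χ

/-- An axis acts through a unitary operator `U`, in terms of which the equation `q x = y` is the
homogeneous linear equation `denOp U x = numOp U y`; the points of the unit circle are approximate
eigenvalues of `U` for all vectors that are approximate eigenvectors of the translations. -/
theorem exists_axisOperator {H : Type*} [NormedAddCommGroup H] [InnerProductSpace ℂ H]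
    [CompleteSpace H] (q : Propagation) (τ : Axis q → H →L[ℂ] H) (h0 : τ 0 = 1)
    (hadd : ∀ s t, τ (s + t) = τ s * τ t) (hnorm : ∀ s x, ‖τ s x‖ = ‖x‖)
    (hcont : ∀ x, Continuous fun s => τ s x) :
    ∃ U U' : H →L[ℂ] H, ‖U‖ ≤ 1 ∧ ‖U'‖ ≤ 1 ∧ U * U' = 1 ∧ U' * U = 1 ∧
      (∀ x y, AdvancesTo q Set.univ (fun s => τ s x) 0 y ↔ denOp q U x = numOp q U y) ∧
      (∀ T : H →L[ℂ] H, (∀ s, T * τ s = τ s * T) → T * U = U * T) ∧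
      ∀ u : ℂ, ‖u‖ = 1 → ∃ χ : ℕ → Axis q → ℂ, (∀ n, IsAxisCharacter (χ n)) ∧
        ∀ (w : ℕ → H) (ε : ℕ → ℝ), (∀ n, ‖w n‖ ≤ 1) → Tendsto ε atTop (𝓝 0) →
          (∀ n s, ‖τ s (w n) - χ n s • w n‖ ≤ ε n * (1 + axisAbs q s)) → ApproxEigen w U u := by
  cases q with
  | shift =>
    have hmul : ∀ a b : ℤ, a + b = 0 → τ a * τ b = 1 := fun a b hab => by
      have := hadd a b
      rw [← this]
      exact (congrArg τ hab).trans h0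
    have hle : ∀ s, ‖τ s‖ ≤ 1 := fun s =>
      ContinuousLinearMap.opNorm_le_bound _ zero_le_one fun x => by rw [hnorm, one_mul]
    have h1 : τ (-1 : ℤ) * τ (1 : ℤ) = 1 := hmul _ _ (by norm_num)
    have h2 : τ (1 : ℤ) * τ (-1 : ℤ) = 1 := hmul _ _ (by norm_num)
    -- `U` is the backward shift because `δ` stands for the inverse of `q`; accordingly the
    -- character is `u ^ (-s)`, with value `u` at `s = -1`.
    refine ⟨τ (-1 : ℤ), τ (1 : ℤ), hle _, hle _, h1, h2, fun x y => ?_, fun T hT => hT _,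
      fun u hu => ⟨fun _ => fun s : ℤ => u ^ (-s), fun _ => ⟨?_, ?_, ?_⟩, ?_⟩⟩
    · have h3 : AdvancesTo .shift Set.univ (fun s => τ s x) 0 y ↔ τ (1 : ℤ) x = y := by
        change τ ((0 + 1 : ℤ) : Axis .shift) x = y ↔ _
        rw [zero_add (1 : ℤ)]
      rw [h3]
      change _ ↔ x = τ (-1 : ℤ) y
      constructor
      · rintro rfl
        exact (congrArg (fun T : H →L[ℂ] H => T x) h1).symm
      · rintro rfl
        exact congrArg (fun T : H →L[ℂ] H => T y) h2
    · intro (s : ℤ) (t : ℤ)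
      have hu0 : u ≠ 0 := by
        rintro rfl
        simp at hu
      change u ^ (-(s + t)) = u ^ (-s) * u ^ (-t)
      rw [neg_add, zpow_add₀ hu0]
    · intro (s : ℤ)
      change ‖u ^ (-s)‖ = 1
      rw [norm_zpow, hu, _root_.one_zpow]
    · exact measurable_from_top (α := ℤ)
    · intro w ε _ hε hw
      have hε2 := hε.mul_const 2
      rw [zero_mul] at hε2
      refine squeeze_zero_norm (fun n => ?_) hε2
      have h3 : ‖τ (-1 : ℤ) (w n) - u ^ (-(-1 : ℤ)) • w n‖ ≤ ε n * (1 + |((-1 : ℤ) : ℝ)|) :=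
        hw n (-1 : ℤ)
      norm_num at h3
      exact h3
  | derivative =>
    have hτ : IsIsometricFlow (τ : ℝ → H →L[ℂ] H) := ⟨h0, hadd, hnorm, hcont⟩
    obtain ⟨J, hJ, hJD⟩ := hτ.exists_resolvent
    obtain ⟨J', -, hJD'⟩ := hτ.neg.exists_resolvent
    have hJ1 : ∀ f, HasDerivAt (fun s : ℝ => τ s (J f)) (J f - f) 0 := fun f =>
      (hJD _ _).2 (by rw [sub_sub_cancel])
    have hJ1' : ∀ f, HasDerivAt (fun s : ℝ => τ (-s) (J' f)) (J' f - f) 0 := fun f =>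
      (hJD' _ _).2 (by rw [sub_sub_cancel])
    have happ : ∀ (V : H →L[ℂ] H) (f : H), ((2 : ℂ) • V - 1) f = V f + V f - f := fun V f => by
      rw [_root_.sub_apply, _root_.smul_apply, one_apply_eq_self, two_smul]
    -- With `x = J f` one has `f = x - D x` and `(2J - 1) f = x + D x`.
    have hU : ∀ f, ‖((2 : ℂ) • J - 1) f‖ ≤ 1 * ‖f‖ := fun f => by
      have h1 := hτ.norm_add_eq_norm_sub (hJ1 f)
      rw [sub_sub_cancel] at h1
      rw [one_mul, ← h1]
      apply le_of_eq
      congr 1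
      rw [happ]
      abel
    have hU' : ∀ f, ‖((2 : ℂ) • J' - 1) f‖ ≤ 1 * ‖f‖ := fun f => by
      have h1 := hτ.neg.norm_add_eq_norm_sub (hJ1' f)
      rw [sub_sub_cancel] at h1
      rw [one_mul, ← h1]
      apply le_of_eq
      congr 1
      rw [happ]
      abel
    have hdn : ∀ x y, AdvancesTo .derivative Set.univ (fun s => τ s x) 0 y ↔
        HasDerivAt (fun s : ℝ => τ s x) y 0 := fun x y =>
      hasDerivWithinAt_univ (f := fun s : ℝ => τ s x) (x := (0 : ℝ))
    -- The Cayley transforms of `D` and of `-D`, the generator of the reversed flow, are inverse to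
    -- each other.
    refine ⟨(2 : ℂ) • J - 1, (2 : ℂ) • J' - 1,
      ContinuousLinearMap.opNorm_le_bound _ zero_le_one hU,
      ContinuousLinearMap.opNorm_le_bound _ zero_le_one hU', ?_, ?_, fun x y => ?_, fun T hT => ?_,
      fun u hu => ?_⟩
    · ext f
      have h1 := IsIsometricFlow.hasDerivAt_neg_iff.1 (hJ1' f)
      rw [hJD] at h1
      have h2 : ((2 : ℂ) • J' - 1) f = J' f - -(J' f - f) := by
        rw [happ]
        abel
      rw [mul_apply_eq_comp, h2, happ, h1, one_apply_eq_self]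
      abel
    · ext f
      have h1 := hJ1 f
      rw [show J f - f = -(f - J f) by abel, ← IsIsometricFlow.hasDerivAt_neg_iff (τ := τ)] at h1
      rw [hJD'] at h1
      have h2 : ((2 : ℂ) • J - 1) f = J f - (f - J f) := by
        rw [happ]
        abel
      rw [mul_apply_eq_comp, h2, happ, h1, one_apply_eq_self]
      abel
    · have h1 : denOp .derivative ((2 : ℂ) • J - 1) = J - 1 := by
        change (1 / 2 : ℂ) • ((2 : ℂ) • J - 1 - 1) = _
        module
      have h2 : numOp .derivative ((2 : ℂ) • J - 1) = J := by
        change (1 / 2 : ℂ) • ((2 : ℂ) • J - 1 + 1) = _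
        module
      rw [hdn, hJD, h1, h2, _root_.sub_apply, one_apply_eq_self, map_sub, sub_eq_iff_eq_add,
        sub_eq_iff_eq_add, add_comm]
    · have h1 : T * J = J * T := by
        ext f
        have h2 := (T.restrictScalars ℝ).hasFDerivAt.comp_hasDerivAt (0 : ℝ) (hJ1 f)
        have h3 : HasDerivAt (fun s : ℝ => τ s (T (J f))) (T (J f) - T f) 0 := by
          rw [← map_sub]
          refine HasDerivAt.congr_deriv (h2.congr_of_eventuallyEq (Eventually.of_forall ?_)) rfl
          intro s
          exact (congrArg (fun V : H →L[ℂ] H => V (J f)) (hT s)).symm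
        have h4 := (hJD _ _).1 h3
        rw [sub_sub_cancel] at h4
        exact h4.symm
      rw [mul_sub, sub_mul, mul_smul_comm, smul_mul_assoc, h1, mul_one, one_mul]
    · obtain ⟨ω, hω⟩ := exists_frequency hu
      refine ⟨fun n => fun s : ℝ => Complex.exp (ω n * s * Complex.I), fun n => ⟨?_, ?_, ?_⟩, ?_⟩
      · intro (s : ℝ) (t : ℝ)
        change Complex.exp (ω n * ((s + t : ℝ) : ℂ) * Complex.I) = _
        rw [← Complex.exp_add]
        push_cast
        ring_nf
      · intro (s : ℝ)
        change ‖Complex.exp (ω n * s * Complex.I)‖ = 1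
        rw [← Complex.ofReal_mul, Complex.norm_exp_ofReal_mul_I]
      · have : Measurable fun s : ℝ => Complex.exp (ω n * s * Complex.I) := by fun_prop
        exact this
      · intro w ε hw1 hε hw
        have h1 : Tendsto (fun n => 2 * (4 * ε n) +
            2 * ‖1 / (1 - ω n * Complex.I) - (1 / 2 : ℂ) * (u + 1)‖) atTop (𝓝 0) := by
          have h2 := (tendsto_iff_norm_sub_tendsto_zero.1 hω).const_mul 2
          have h3 := (hε.const_mul 4).const_mul 2
          simpa using h3.add h2
        refine squeeze_zero_norm (fun n => ?_) h1
        have h4 := hτ.norm_resolvent_sub_le hJ (w n) (ω n) (ε n) fun s hs => by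
          have : ‖τ s (w n) - Complex.exp (ω n * s * Complex.I) • w n‖ ≤ ε n * (1 + |s|) := hw n s
          rwa [abs_of_nonneg hs] at this
        have h5 : ((2 : ℂ) • J - 1) (w n) - u • w n =
            (2 : ℂ) • (J (w n) - (1 / (1 - ω n * Complex.I)) • w n) +
            (2 * (1 / (1 - ω n * Complex.I) - (1 / 2 : ℂ) * (u + 1))) • w n := by
          rw [_root_.sub_apply, _root_.smul_apply, one_apply_eq_self]
          module
        rw [h5]
        refine (norm_add_le _ _).trans (add_le_add ?_ ?_)
        · rw [norm_smul, Complex.norm_ofNat]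
          linarith
        · rw [norm_smul, norm_mul, Complex.norm_ofNat]
          exact mul_le_of_le_one_right (by positivity) (hw1 n)

end Flows

section Translations

/-! ### Topology of the axes and strong continuity of translations -/

instance : ∀ q, BorelSpace (Axis q)
  | .derivative => inferInstanceAs (BorelSpace ℝ)
  | .shift => inferInstanceAs (BorelSpace ℤ)

instance : ∀ q, SecondCountableTopology (Axis q)
  | .derivative => inferInstanceAs (SecondCountableTopology ℝ)
  | .shift => inferInstanceAs (SecondCountableTopology ℤ)

instance : ∀ q, TopologicalSpace.PseudoMetrizableSpace (Axis q)
  | .derivative => inferInstanceAs (TopologicalSpace.PseudoMetrizableSpace ℝ)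
  | .shift => inferInstanceAs (TopologicalSpace.PseudoMetrizableSpace ℤ)

instance : ∀ q, SigmaCompactSpace (Axis q)
  | .derivative => inferInstanceAs (SigmaCompactSpace ℝ)
  | .shift => inferInstanceAs (SigmaCompactSpace ℤ)

instance : ∀ q, ContinuousAdd (Axis q)
  | .derivative => inferInstanceAs (ContinuousAdd ℝ)
  | .shift => inferInstanceAs (ContinuousAdd ℤ)

instance : ∀ q, IsLocallyFiniteMeasure (axisMeasure q)
  | .derivative => inferInstanceAs (IsLocallyFiniteMeasure (volume : Measure ℝ))
  | .shift => ⟨fun x : ℤ => ⟨({x} : Set ℤ), (isOpen_discrete ({x} : Set ℤ)).mem_nhds rfl,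
      show (Measure.count : Measure ℤ) {x} < ⊤ by simp⟩⟩

variable {m : ℕ} {q : Fin m → Propagation}

/-- Complex scalar signals. -/
abbrev ComplexSignal (q : Fin m → Propagation) : Type := Lp ℂ 2 (gridMeasure q)

/-- Translation of complex scalar signals along an axis. -/
def shiftOp (i : Fin m) (h : Axis (q i)) : ComplexSignal q →L[ℂ] ComplexSignal q :=
  (Lp.compMeasurePreservingₗᵢ ℂ (fun j : Grid q => j + Pi.single i h)
    (measurePreserving_step q i h)).toContinuousLinearMap

theorem coeFn_shiftOp (i : Fin m) (h : Axis (q i)) (x : ComplexSignal q) :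
    shiftOp i h x =ᵐ[gridMeasure q] fun j => x (j + Pi.single i h) :=
  Lp.coeFn_compMeasurePreserving x (measurePreserving_step q i h)

theorem norm_shiftOp (i : Fin m) (h : Axis (q i)) (x : ComplexSignal q) :
    ‖shiftOp i h x‖ = ‖x‖ :=
  Lp.norm_compMeasurePreserving x (measurePreserving_step q i h)

theorem shiftOp_mul_apply (i i' : Fin m) (h : Axis (q i)) (h' : Axis (q i'))
    (x : ComplexSignal q) :
    shiftOp i h (shiftOp i' h' x) =ᵐ[gridMeasure q]
      fun j => x (j + (Pi.single i h + Pi.single i' h')) := by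
  refine (coeFn_shiftOp i h _).trans ?_
  have := (measurePreserving_step q i h).quasiMeasurePreserving.ae_eq_comp
    (coeFn_shiftOp i' h' x)
  refine this.trans (Eventually.of_forall fun j => ?_)
  simp [add_assoc]

theorem shiftOp_commute (i i' : Fin m) (h : Axis (q i)) (h' : Axis (q i')) :
    shiftOp i h * shiftOp i' h' = shiftOp i' h' * shiftOp i h := by
  ext1 x
  apply Lp.ext
  refine (shiftOp_mul_apply i i' h h' x).trans ?_
  refine EventuallyEq.trans ?_ (shiftOp_mul_apply i' i h' h x).symm
  rw [add_comm]

theorem shiftOp_add (i : Fin m) (h h' : Axis (q i)) :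
    (shiftOp i (h + h') : ComplexSignal q →L[ℂ] ComplexSignal q) = shiftOp i h * shiftOp i h' := by
  ext1 x
  apply Lp.ext
  refine (coeFn_shiftOp i (h + h') x).trans ?_
  refine EventuallyEq.trans ?_ (shiftOp_mul_apply i i h h' x).symm
  rw [Pi.single_add]

theorem shiftOp_zero (i : Fin m) :
    (shiftOp i 0 : ComplexSignal q →L[ℂ] ComplexSignal q) = 1 := by
  ext1 x
  apply Lp.ext
  refine (coeFn_shiftOp i 0 x).trans (Eventually.of_forall fun j => ?_)
  simp

theorem continuous_shiftOp (i : Fin m) (x : ComplexSignal q) :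
    Continuous fun h : Axis (q i) => shiftOp i h x := by
  have hs : Continuous fun h : Axis (q i) => (Pi.single i h : Grid q) :=
    continuous_single (A := fun i => Axis (q i)) i
  have hs' : Continuous fun p : Axis (q i) × Grid q => p.2 + (Pi.single i p.1 : Grid q) := by
    refine Continuous.add continuous_snd ?_
    exact hs.comp continuous_fst
  let g : Axis (q i) → C(Grid q, Grid q) := ContinuousMap.curry ⟨_, hs'⟩
  have hg : Continuous g := ContinuousMap.continuous _
  exact Continuous.compMeasurePreservingLp (g := g) continuous_const hg
    (measurePreserving_step q i) ENNReal.ofNat_ne_top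

/-! ### Plane waves on large boxes are approximate eigenvectors -/

/-- An interval of length `N`. -/
def axisBox : ∀ q, ℕ → Set (Axis q)
  | .derivative => fun N => (Set.Ico 0 (N : ℝ) : Set ℝ)
  | .shift => fun N => (Set.Ico 0 (N : ℤ) : Set ℤ)

theorem measurableSet_axisBox (q : Propagation) (N : ℕ) : MeasurableSet (axisBox q N) := by
  cases q with
  | derivative => exact measurableSet_Ico (α := ℝ)
  | shift => exact MeasurableSet.of_discrete (α := ℤ)

theorem count_Ico_int (a b : ℤ) :
    (Measure.count : Measure ℤ) (Set.Ico a b) = ((b - a).toNat : ENNReal) := by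
  rw [← Finset.coe_Ico, Measure.count_apply_finset, Int.card_Ico]

theorem axisMeasure_axisBox (q : Propagation) (N : ℕ) : axisMeasure q (axisBox q N) = N := by
  cases q with
  | derivative =>
    change (volume : Measure ℝ) (Set.Ico 0 (N : ℝ)) = N
    rw [Real.volume_Ico, sub_zero, ENNReal.ofReal_natCast]
  | shift =>
    change (Measure.count : Measure ℤ) (Set.Ico 0 (N : ℤ)) = N
    rw [count_Ico_int, sub_zero, Int.toNat_natCast]

/-- The symmetric difference of an interval and its translate is small. -/
theorem exists_axisBox_symmDiff (q : Propagation) (N : ℕ) (s : Axis q) :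
    ∃ D : Set (Axis q), axisMeasure q D ≤ ENNReal.ofReal (4 * axisAbs q s) ∧
      ∀ j, ¬(j ∈ axisBox q N ↔ j + s ∈ axisBox q N) → j ∈ D := by
  cases q with
  | derivative =>
    revert s
    intro (s : ℝ)
    -- Membership can change only within `|s|` of an endpoint: two intervals of length `2|s|`.
    refine ⟨(Set.Ico (-|s|) |s| ∪ Set.Ico (N - |s|) (N + |s|) : Set ℝ), ?_, ?_⟩
    · refine (measure_union_le (μ := (volume : Measure ℝ)) _ _).trans ?_
      rw [Real.volume_Ico, Real.volume_Ico, ← ENNReal.ofReal_add (by linarith [abs_nonneg s])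
        (by linarith [abs_nonneg s])]
      apply ENNReal.ofReal_le_ofReal
      change _ ≤ 4 * |s|
      linarith
    · intro (j : ℝ)
      change ¬((0 ≤ j ∧ j < (N : ℝ)) ↔ (0 ≤ j + s ∧ j + s < (N : ℝ))) →
        (-|s| ≤ j ∧ j < |s|) ∨ ((N : ℝ) - |s| ≤ j ∧ j < N + |s|)
      intro h
      have h1 := le_abs_self s
      have h2 := neg_abs_le s
      by_contra h3
      apply h
      rw [not_or, not_and_or, not_and_or, not_le, not_lt, not_le, not_lt] at h3
      obtain ⟨h4 | h4, h5 | h5⟩ := h3 <;> constructor <;> rintro ⟨h6, h7⟩ <;> constructor <;>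
        linarith
  | shift =>
    revert s
    intro (s : ℤ)
    refine ⟨(Set.Ico (-|s|) |s| ∪ Set.Ico (N - |s|) (N + |s|) : Set ℤ), ?_, ?_⟩
    · refine (measure_union_le (μ := (Measure.count : Measure ℤ)) _ _).trans ?_
      rw [count_Ico_int, count_Ico_int, ← Nat.cast_add, ← ENNReal.ofReal_natCast]
      apply ENNReal.ofReal_le_ofReal
      change _ ≤ 4 * |(s : ℝ)|
      rw [← Int.cast_abs]
      have : ((((|s| - -|s|).toNat + ((N : ℤ) + |s| - (N - |s|)).toNat : ℕ)) : ℤ) ≤ 4 * |s| := by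
        have := abs_nonneg s
        omega
      exact_mod_cast this
    · intro (j : ℤ)
      change ¬((0 ≤ j ∧ j < (N : ℤ)) ↔ (0 ≤ j + s ∧ j + s < (N : ℤ))) →
        (-|s| ≤ j ∧ j < |s|) ∨ ((N : ℤ) - |s| ≤ j ∧ j < N + |s|)
      have h1 := le_abs_self s
      have h2 := neg_abs_le s
      omega

/-- A box with sides of length `N`. -/
def gridBox (q : Fin m → Propagation) (N : ℕ) : Set (Grid q) :=
  Set.univ.pi fun i => axisBox (q i) N

theorem measurableSet_gridBox (q : Fin m → Propagation) (N : ℕ) :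
    MeasurableSet (gridBox q N) :=
  MeasurableSet.univ_pi fun i => measurableSet_axisBox (q i) N

theorem gridMeasure_gridBox (q : Fin m → Propagation) (N : ℕ) :
    gridMeasure q (gridBox q N) = (N : ENNReal) ^ m := by
  rw [gridBox, Measure.pi_pi]
  simp [axisMeasure_axisBox]

/-- The symmetric difference of a box and its translate is small. -/
theorem exists_gridBox_symmDiff (q : Fin m → Propagation) (N : ℕ) (i : Fin m) (s : Axis (q i)) :
    ∃ D : Set (Grid q),
      gridMeasure q D * N ≤ ENNReal.ofReal (4 * axisAbs (q i) s) * (N : ENNReal) ^ m ∧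
      ∀ j, ¬(j ∈ gridBox q N ↔ j + Pi.single i s ∈ gridBox q N) → j ∈ D := by
  obtain ⟨E, hE, hE'⟩ := exists_axisBox_symmDiff (q i) N s
  -- Only the `i`-th side of the box is replaced by the exceptional set, so the measure gains a
  -- factor `4|s|` and loses a factor `N`.
  set E' := Function.update (fun i' => axisBox (q i') N) i E with hE'def
  have hsub : ∀ j, ¬(j ∈ gridBox q N ↔ j + Pi.single i s ∈ gridBox q N) → j ∈ Set.univ.pi E' := by
    intro j hj
    have hoff : ∀ i' ≠ i, (j + (Pi.single i s : Grid q)) i' = j i' := fun i' hi' => by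
      simp [Pi.single_eq_of_ne hi']
    have hon : (j + (Pi.single i s : Grid q)) i = j i + s := by simp
    have hall : ∀ i' ≠ i, j i' ∈ axisBox (q i') N := by
      by_contra h
      push Not at h
      obtain ⟨i', hi', h'⟩ := h
      refine hj ⟨fun h1 => absurd (h1 i' trivial) h', fun h1 => ?_⟩
      have := h1 i' trivial
      rw [hoff i' hi'] at this
      exact absurd this h'
    have hi : j i ∈ E := by
      apply hE'
      intro hiff
      apply hj
      constructor
      · intro h1 i' _
        by_cases hi' : i' = i
        · subst hi'
          rw [hon]
          exact hiff.1 (h1 i' trivial)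
        · rw [hoff i' hi']
          exact hall i' hi'
      · intro h1 i' _
        by_cases hi' : i' = i
        · subst hi'
          have := h1 i' trivial
          rw [hon] at this
          exact hiff.2 this
        · exact hall i' hi'
    intro i' _
    by_cases hi' : i' = i
    · subst hi'
      simpa [hE'def] using hi
    · simpa [hE'def, Function.update_of_ne hi'] using hall i' hi'
  refine ⟨Set.univ.pi E', ?_, hsub⟩
  rw [Measure.pi_pi, ← Finset.mul_prod_erase _ _ (Finset.mem_univ i)]
  have h1 : ∏ i' ∈ Finset.univ.erase i, axisMeasure (q i') (E' i') = (N : ENNReal) ^ (m - 1) := by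
    rw [Finset.prod_congr rfl (g := fun _ => (N : ENNReal)), Finset.prod_const,
      Finset.card_erase_of_mem (Finset.mem_univ i), Finset.card_univ, Fintype.card_fin]
    intro i' hi'
    rw [hE'def, Function.update_of_ne (Finset.ne_of_mem_erase hi'), axisMeasure_axisBox]
  have hm : m - 1 + 1 = m := Nat.sub_add_cancel (Nat.one_le_of_lt i.2)
  rw [h1, mul_assoc, ← pow_succ, hm, hE'def, Function.update_self]
  gcongr

/-- The plane wave with the given characters, cut off to a box. -/
def boxWave (N : ℕ) (χ : ∀ i, Axis (q i) → ℂ) : Grid q → ℂ :=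
  (gridBox q N).indicator fun j => ∏ i, χ i (j i)

variable {χ : ∀ i, Axis (q i) → ℂ}

theorem eLpNorm_le_of_norm_le_indicator {D : Set (Grid q)} {f : Grid q → ℂ}
    (hf : ∀ j, ‖f j‖ ≤ D.indicator (fun _ => (1 : ℝ)) j) :
    eLpNorm f 2 (gridMeasure q) ≤ gridMeasure q D ^ (1 / 2 : ℝ) := by
  refine (eLpNorm_mono_real hf).trans ?_
  refine (eLpNorm_indicator_const_le (1 : ℝ) 2).trans ?_
  simp

theorem norm_boxWave (hχ : ∀ i, IsAxisCharacter (χ i)) (N : ℕ) (j : Grid q) :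
    ‖boxWave N χ j‖ = (gridBox q N).indicator (fun _ => (1 : ℝ)) j := by
  by_cases hj : j ∈ gridBox q N
  · simp [boxWave, hj, norm_prod, (hχ _).norm]
  · simp [boxWave, hj]

theorem eLpNorm_boxWave (hχ : ∀ i, IsAxisCharacter (χ i)) (N : ℕ) :
    eLpNorm (boxWave N χ) 2 (gridMeasure q) = ((N : ENNReal) ^ m) ^ (1 / 2 : ℝ) := by
  have h1 : eLpNorm (boxWave N χ) 2 (gridMeasure q) =
      eLpNorm ((gridBox q N).indicator fun _ => (1 : ℝ)) 2 (gridMeasure q) := by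
    refine eLpNorm_congr_norm_ae (Eventually.of_forall fun j => ?_)
    rw [norm_boxWave hχ, Real.norm_of_nonneg (Set.indicator_nonneg (fun _ _ => zero_le_one) _)]
  rw [h1, eLpNorm_indicator_const (measurableSet_gridBox q N) two_ne_zero ENNReal.ofNat_ne_top,
    gridMeasure_gridBox]
  simp

theorem memLp_boxWave (hχ : ∀ i, IsAxisCharacter (χ i)) (N : ℕ) :
    MemLp (boxWave N χ) 2 (gridMeasure q) := by
  refine ⟨?_, ?_⟩
  · refine (Measurable.indicator ?_ (measurableSet_gridBox q N)).aestronglyMeasurable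
    exact Finset.measurable_fun_prod _ fun i _ => (hχ i).measurable.comp (measurable_pi_apply i)
  · rw [eLpNorm_boxWave hχ]
    exact ENNReal.rpow_lt_top_of_nonneg (by norm_num)
      (ENNReal.pow_ne_top (ENNReal.natCast_ne_top N))

/-- The full plane wave is an exact eigenfunction of the translation. An error arises only where
exactly one of the two points lies in the box, and there a single term of modulus 1 survives. -/
theorem norm_boxWave_step_sub_le (hχ : ∀ i, IsAxisCharacter (χ i)) (N : ℕ) (i : Fin m)
    (s : Axis (q i)) {D : Set (Grid q)}
    (hD : ∀ j, ¬(j ∈ gridBox q N ↔ j + Pi.single i s ∈ gridBox q N) → j ∈ D) (j : Grid q) :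
    ‖boxWave N χ (j + Pi.single i s) - χ i s * boxWave N χ j‖ ≤
      D.indicator (fun _ => (1 : ℝ)) j := by
  have hprod : ∏ i', χ i' ((j + (Pi.single i s : Grid q)) i') = χ i s * ∏ i', χ i' (j i') := by
    rw [← Finset.mul_prod_erase _ _ (Finset.mem_univ i),
      ← Finset.mul_prod_erase _ (fun i' => χ i' (j i')) (Finset.mem_univ i), ← mul_assoc]
    congr 1
    · rw [Pi.add_apply, Pi.single_eq_same, (hχ i).add, mul_comm]
    · refine Finset.prod_congr rfl fun i' hi' => ?_
      rw [Pi.add_apply, Pi.single_eq_of_ne (Finset.ne_of_mem_erase hi'), add_zero]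
  by_cases hj : j ∈ gridBox q N <;> by_cases hj' : j + Pi.single i s ∈ gridBox q N
  · rw [boxWave, Set.indicator_of_mem hj, Set.indicator_of_mem hj', hprod, sub_self, norm_zero]
    exact Set.indicator_nonneg (fun _ _ => zero_le_one) _
  · rw [Set.indicator_of_mem (hD j (by simp [hj, hj']))]
    simp [boxWave, Set.indicator_of_mem hj, Set.indicator_of_notMem hj', norm_prod, (hχ _).norm]
  · rw [Set.indicator_of_mem (hD j (by simp [hj, hj']))]
    rw [boxWave, Set.indicator_of_notMem hj, Set.indicator_of_mem hj', hprod]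
    simp [norm_prod, (hχ _).norm]
  · simp only [boxWave, Set.indicator_of_notMem hj, Set.indicator_of_notMem hj', mul_zero,
      sub_self, norm_zero]
    exact Set.indicator_nonneg (fun _ _ => zero_le_one) _

/-- Unit vectors that are nearly eigenvectors of all translations. -/
theorem exists_almost_eigenvector (hχ : ∀ i, IsAxisCharacter (χ i)) {N : ℕ} (hN : 0 < N) :
    ∃ w : ComplexSignal q, ‖w‖ = 1 ∧ ∀ i (s : Axis (q i)),
      ‖shiftOp i s w - χ i s • w‖ ≤ 2 / Real.sqrt N * (1 + axisAbs (q i) s) := by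
  set F : ComplexSignal q := (memLp_boxWave hχ N).toLp _ with hF
  have hN' : (0 : ℝ) < N := by exact_mod_cast hN
  have hFn : ‖F‖ = Real.sqrt ((N : ℝ) ^ m) := by
    rw [hF, Lp.norm_toLp, eLpNorm_boxWave hχ, ← ENNReal.toReal_rpow, ENNReal.toReal_pow,
      ENNReal.toReal_natCast, Real.sqrt_eq_rpow]
  have hF0 : 0 < ‖F‖ := by
    rw [hFn]
    positivity
  refine ⟨(‖F‖⁻¹ : ℂ) • F, ?_, fun i s => ?_⟩
  · rw [norm_smul, norm_inv, Complex.norm_real, norm_norm, inv_mul_cancel₀ hF0.ne']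
  obtain ⟨D, hD, hD'⟩ := exists_gridBox_symmDiff q N i s
  have hs0 := axisAbs_nonneg (q i) s
  have h1 : ‖shiftOp i s F - χ i s • F‖ ≤ Real.sqrt (4 * axisAbs (q i) s * N ^ m / N) := by
    have hae : ⇑(shiftOp i s F - χ i s • F) =ᵐ[gridMeasure q]
        fun j => boxWave N χ (j + Pi.single i s) - χ i s * boxWave N χ j := by
      have h2 := (measurePreserving_step q i s).quasiMeasurePreserving.ae_eq_comp
        (MemLp.coeFn_toLp (memLp_boxWave hχ N))
      filter_upwards [Lp.coeFn_sub (shiftOp i s F) (χ i s • F), Lp.coeFn_smul (χ i s) F,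
        coeFn_shiftOp i s F, h2, MemLp.coeFn_toLp (memLp_boxWave hχ N)] with j h3 h4 h5 h6 h7
      simp only [Function.comp_apply] at h6
      rw [h3, Pi.sub_apply, h4, Pi.smul_apply, h5, hF, h6, h7, smul_eq_mul]
    have hDle : gridMeasure q D ≤ ENNReal.ofReal (4 * axisAbs (q i) s * N ^ m / N) := by
      rw [ENNReal.ofReal_div_of_pos hN', ENNReal.ofReal_natCast,
        ENNReal.le_div_iff_mul_le (Or.inl (by exact_mod_cast hN.ne'))
          (Or.inl (ENNReal.natCast_ne_top N)), ENNReal.ofReal_mul (by positivity),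
        ENNReal.ofReal_pow hN'.le, ENNReal.ofReal_natCast]
      exact hD
    have h8 := (eLpNorm_le_of_norm_le_indicator
      (norm_boxWave_step_sub_le hχ N i s hD')).trans
      (ENNReal.rpow_le_rpow hDle (by norm_num : (0 : ℝ) ≤ 1 / 2))
    rw [Lp.norm_def, eLpNorm_congr_ae hae, Real.sqrt_eq_rpow]
    refine ENNReal.toReal_le_of_le_ofReal (by positivity) ?_
    rwa [← ENNReal.ofReal_rpow_of_nonneg (by positivity) (by norm_num)]
  rw [map_smul, smul_comm, ← smul_sub, norm_smul, norm_inv, Complex.norm_real, norm_norm,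
    inv_mul_le_iff₀ hF0]
  refine h1.trans ?_
  -- After division by `‖F‖ = √(N ^ m)` the error is at most `√(4|s| / N)`, and `√(4|s|) ≤ 2(1 +
  -- |s|)`.
  rw [show 4 * axisAbs (q i) s * (N : ℝ) ^ m / N = (N : ℝ) ^ m * (4 * axisAbs (q i) s / N) by ring,
    Real.sqrt_mul (by positivity), ← hFn]
  refine mul_le_mul_of_nonneg_left ?_ hF0.le
  rw [Real.sqrt_div (by positivity), div_mul_eq_mul_div]
  gcongr
  rw [Real.sqrt_le_left (by positivity)]
  nlinarith

end Translations

section Signals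

variable {m : ℕ} {q : Fin m → Propagation} {d e : ℕ}

/-! ### Real and complex signals -/

theorem compLp_comp {E F G : Type*} [NormedAddCommGroup E] [NormedSpace ℝ E]
    [NormedAddCommGroup F] [NormedSpace ℝ F] [NormedAddCommGroup G] [NormedSpace ℝ G]
    (L : F →L[ℝ] G) (L' : E →L[ℝ] F) (x : Lp E 2 (gridMeasure q)) :
    L.compLp (L'.compLp x) = (L.comp L').compLp x := by
  apply Lp.ext
  filter_upwards [L.coeFn_compLp (L'.compLp x), L'.coeFn_compLp x, (L.comp L').coeFn_compLp x]
    with j h1 h2 h3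
  rw [h1, h2, h3]
  rfl

theorem compLp_compMeasurePreserving {E F : Type*} [NormedAddCommGroup E] [NormedSpace ℝ E]
    [NormedAddCommGroup F] [NormedSpace ℝ F] (L : E →L[ℝ] F) (x : Lp E 2 (gridMeasure q))
    {f : Grid q → Grid q} (hf : MeasurePreserving f (gridMeasure q) (gridMeasure q)) :
    L.compLp (Lp.compMeasurePreserving f hf x) = Lp.compMeasurePreserving f hf (L.compLp x) := by
  apply Lp.ext
  filter_upwards [L.coeFn_compLp (Lp.compMeasurePreserving f hf x),
    Lp.coeFn_compMeasurePreserving x hf, Lp.coeFn_compMeasurePreserving (L.compLp x) hf,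
    hf.quasiMeasurePreserving.ae_eq_comp (L.coeFn_compLp' x)] with j h1 h2 h3 h4
  simp only [Function.comp_apply] at h2 h3 h4
  rw [h1, h2, h3, h4]

/-- The coordinates of a real vector signal, as complex scalar signals. -/
def toComplex (q : Fin m → Propagation) (d : ℕ) (a : Fin d) : Signal q d →L[ℝ] ComplexSignal q :=
  (Complex.ofRealCLM.comp (EuclideanSpace.proj a : EuclideanSpace ℝ (Fin d) →L[ℝ] ℝ)).compLpL 2
    (gridMeasure q)

/-- The real part of a complex scalar signal, as a coordinate of a real vector signal. -/
def ofComplex (q : Fin m → Propagation) (d : ℕ) (a : Fin d) : ComplexSignal q →L[ℝ] Signal q d :=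
  ((ContinuousLinearMap.toSpanSingleton ℝ (EuclideanSpace.single a (1 : ℝ))).comp
    Complex.reCLM).compLpL 2 (gridMeasure q)

/-- All coordinates of a real vector signal, as complex scalar signals. -/
def toComplexVec (q : Fin m → Propagation) (d : ℕ) :
    Signal q d →L[ℝ] (Fin d → ComplexSignal q) :=
  ContinuousLinearMap.pi (toComplex q d)

/-- The real part of a vector of complex scalar signals, as a real vector signal. -/
def ofComplexVec (q : Fin m → Propagation) (d : ℕ) :
    (Fin d → ComplexSignal q) →L[ℝ] Signal q d :=
  ∑ a, (ofComplex q d a).comp (ContinuousLinearMap.proj a)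

theorem ofComplexVec_apply (X : Fin d → ComplexSignal q) :
    ofComplexVec q d X = ∑ a, ofComplex q d a (X a) := by
  simp [ofComplexVec]

theorem sum_compLpL {α E F : Type*} [Fintype α] [NormedAddCommGroup E] [NormedSpace ℝ E]
    [NormedAddCommGroup F] [NormedSpace ℝ F] (L : α → E →L[ℝ] F) :
    ∑ a, (L a).compLpL 2 (gridMeasure q) = (∑ a, L a).compLpL 2 (gridMeasure q) := by
  classical
  induction (Finset.univ : Finset α) using Finset.induction_on with
  | empty =>
    ext1 x
    apply Lp.ext
    filter_upwards [Lp.coeFn_zero F 2 (gridMeasure q),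
      (0 : E →L[ℝ] F).coeFn_compLp (p := 2) x] with j h1 h2
    simp only [Finset.sum_empty, _root_.zero_apply]
    rw [h1]
    exact h2.symm
  | insert i s hi ih =>
    rw [Finset.sum_insert hi, Finset.sum_insert hi, ih, ContinuousLinearMap.add_compLpL]

theorem ofComplexVec_toComplexVec (x : Signal q d) :
    ofComplexVec q d (toComplexVec q d x) = x := by
  rw [ofComplexVec_apply]
  have h1 : ∀ a, ofComplex q d a (toComplexVec q d x a) =
      (((ContinuousLinearMap.toSpanSingleton ℝ (EuclideanSpace.single a (1 : ℝ))).comp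
        Complex.reCLM).comp (Complex.ofRealCLM.comp
          (EuclideanSpace.proj a : EuclideanSpace ℝ (Fin d) →L[ℝ] ℝ))).compLpL 2
            (gridMeasure q) x := fun a => compLp_comp _ _ x
  simp only [h1]
  rw [← _root_.sum_apply, sum_compLpL]
  apply Lp.ext
  filter_upwards [ContinuousLinearMap.coeFn_compLpL (p := 2) (μ := gridMeasure q)
    (∑ a : Fin d, ((ContinuousLinearMap.toSpanSingleton ℝ (EuclideanSpace.single a (1 : ℝ))).comp
        Complex.reCLM).comp (Complex.ofRealCLM.comp
          (EuclideanSpace.proj a : EuclideanSpace ℝ (Fin d) →L[ℝ] ℝ))) x] with j hj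
  rw [hj]
  ext b
  simp [_root_.sum_apply, Pi.single_apply]

/-- Since `Re (-iX) = Im X`, a complex signal is recovered from two real ones. This carries bounds
on real trajectories over to complex solutions. -/
theorem toComplexVec_ofComplexVec (X : Fin d → ComplexSignal q) :
    X = toComplexVec q d (ofComplexVec q d X) +
      Complex.I • toComplexVec q d (ofComplexVec q d (-Complex.I • X)) := by
  have h1 : ∀ (Z : Fin d → ComplexSignal q) (a : Fin d),
      toComplexVec q d (ofComplexVec q d Z) a =
        (Complex.ofRealCLM.comp Complex.reCLM).compLp (Z a) := by
    intro Z a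
    rw [ofComplexVec_apply, map_sum, Finset.sum_apply, Finset.sum_eq_single a]
    · refine (compLp_comp _ _ (Z a)).trans ?_
      congr 1
      ext z
      simp
    · intro b _ hb
      refine (compLp_comp _ _ (Z b)).trans ?_
      apply Lp.ext
      filter_upwards [Lp.coeFn_zero ℂ 2 (gridMeasure q), ContinuousLinearMap.coeFn_compLp
        ((Complex.ofRealCLM.comp (EuclideanSpace.proj a : EuclideanSpace ℝ (Fin d) →L[ℝ] ℝ)).comp
          ((ContinuousLinearMap.toSpanSingleton ℝ (EuclideanSpace.single b (1 : ℝ))).comp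
            Complex.reCLM)) (Z b)] with j h2 h3
      refine h3.trans (Eq.trans ?_ h2.symm)
      simp [hb.symm]
    · simp
  ext1 a
  rw [Pi.add_apply, Pi.smul_apply, h1, h1]
  apply Lp.ext
  filter_upwards [ContinuousLinearMap.coeFn_compLp (Complex.ofRealCLM.comp Complex.reCLM) (X a),
    ContinuousLinearMap.coeFn_compLp (Complex.ofRealCLM.comp Complex.reCLM) ((-Complex.I • X) a),
    Lp.coeFn_smul (-Complex.I) (X a),
    Lp.coeFn_smul Complex.I
      ((Complex.ofRealCLM.comp Complex.reCLM).compLp ((-Complex.I • X) a)),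
    Lp.coeFn_add ((Complex.ofRealCLM.comp Complex.reCLM).compLp (X a))
      (Complex.I • (Complex.ofRealCLM.comp Complex.reCLM).compLp ((-Complex.I • X) a))]
    with j h2 h3 h4 h5 h6
  rw [h6, Pi.add_apply, h5, Pi.smul_apply, h2, h3, Pi.smul_apply, h4, Pi.smul_apply]
  apply Complex.ext <;> simp

theorem toComplex_translate (i : Fin m) (h : Axis (q i)) (x : Signal q d) (a : Fin d) :
    toComplex q d a (translate i x h) = shiftOp i h (toComplex q d a x) :=
  compLp_compMeasurePreserving _ x (measurePreserving_step q i h)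

theorem ofComplex_shiftOp (i : Fin m) (h : Axis (q i)) (x : ComplexSignal q) (a : Fin d) :
    ofComplex q d a (shiftOp i h x) = translate i (ofComplex q d a x) h :=
  compLp_compMeasurePreserving _ x (measurePreserving_step q i h)

theorem translate_ofComplexVec (i : Fin m) (h : Axis (q i)) (X : Fin d → ComplexSignal q) :
    translate i (ofComplexVec q d X) h = ∑ a, ofComplex q d a (shiftOp i h (X a)) := by
  simp only [ofComplex_shiftOp, ofComplexVec_apply]
  exact map_sum (Lp.compMeasurePreserving (E := EuclideanSpace ℝ (Fin d)) (p := 2)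
    (μ := gridMeasure q) (μb := gridMeasure q) (fun j : Grid q => j + Pi.single i h) (measurePreserving_step q i h)) _ _

theorem toComplex_matSignal (B : Matrix (Fin e) (Fin d) ℝ) (x : Signal q d) (a : Fin e) :
    toComplex q e a (matSignal B x) = ∑ b, (B a b : ℂ) • toComplex q d b x := by
  have h1 : toComplex q e a (matSignal B x) =
      ((Complex.ofRealCLM.comp (EuclideanSpace.proj a : EuclideanSpace ℝ (Fin e) →L[ℝ] ℝ)).comp
        (LinearMap.toContinuousLinearMap (Matrix.toEuclideanLin B))).compLpL 2
          (gridMeasure q) x := compLp_comp _ _ x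
  have h2 : ∀ b, (B a b : ℂ) • toComplex q d b x =
      (B a b • Complex.ofRealCLM.comp
        (EuclideanSpace.proj b : EuclideanSpace ℝ (Fin d) →L[ℝ] ℝ)).compLpL 2
          (gridMeasure q) x := fun b => by
    rw [ContinuousLinearMap.smul_compLpL, Complex.coe_smul]
    rfl
  rw [h1]
  simp only [h2]
  rw [← _root_.sum_apply, sum_compLpL]
  congr 2
  ext y
  simp [_root_.sum_apply, Matrix.mulVec, dotProduct]

/-- Real matrices commute with taking real parts, so real parts of complex solutions are again
solutions. -/
theorem matSignal_ofComplexVec (B : Matrix (Fin e) (Fin d) ℝ) (X : Fin d → ComplexSignal q) :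
    matSignal B (ofComplexVec q d X) = ofComplexVec q e fun a => ∑ b, (B a b : ℂ) • X b := by
  have h1 : matSignal B (ofComplexVec q d X) = ∑ b, matSignal B (ofComplex q d b (X b)) := by
    rw [ofComplexVec_apply]
    exact map_sum ((LinearMap.toContinuousLinearMap (Matrix.toEuclideanLin B)).compLpL 2
      (gridMeasure q)) _ _
  have h2 : ∀ b, matSignal B (ofComplex q d b (X b)) =
      ∑ a, (B a b) • ofComplex q e a (X b) := fun b => by
    have h3 : ∀ a, (B a b) • ofComplex q e a (X b) =
        ((B a b) • (ContinuousLinearMap.toSpanSingleton ℝ (EuclideanSpace.single a (1 : ℝ))).comp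
          Complex.reCLM).compLpL 2 (gridMeasure q) (X b) := fun a => by
      rw [ContinuousLinearMap.smul_compLpL]
      rfl
    refine (compLp_comp _ _ (X b)).trans ?_
    simp only [h3]
    rw [← _root_.sum_apply, sum_compLpL]
    change ContinuousLinearMap.compLpL 2 (gridMeasure q) _ (X b) = _
    congr 2
    ext z a
    simp [_root_.sum_apply, Pi.single_apply, mul_comm]
  rw [h1, ofComplexVec_apply]
  simp only [h2, map_sum]
  rw [Finset.sum_comm]
  refine Finset.sum_congr rfl fun a _ => Finset.sum_congr rfl fun b _ => ?_
  rw [Complex.coe_smul, map_smul]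

/-! ### Trajectories in complex form -/

namespace Model

variable (S : Model m)

theorem toComplex_rhs (x : S.StateSignal) (i : Fin (m + 1)) (t : Axis (S.q 0))
    (a : Fin (S.k i)) :
    toComplex S.qs (S.k i) a (S.rhs x i t) =
      ∑ b : S.Rest, (S.A i b.1.succ a b.2 : ℂ) •
        toComplex S.qs (S.k b.1.succ) b.2 (x b.1.succ t) +
      ∑ b, (S.A i 0 a b : ℂ) • toComplex S.qs (S.k 0) b (x 0 t) := by
  rw [rhs, map_sum, Fin.sum_univ_succ, add_comm, Fintype.sum_sigma]
  simp only [toComplex_matSignal]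

/-- The real part of complex state signals. -/
def realState (X : Axis (S.q 0) → Fin (S.k 0) → ComplexSignal S.qs)
    (Y : Axis (S.q 0) → S.Rest → ComplexSignal S.qs) : S.StateSignal :=
  Fin.cases (fun t => ofComplexVec S.qs _ (X t))
    (fun i t => ofComplexVec S.qs _ fun a => Y t ⟨i, a⟩)

theorem rhs_realState (X : Axis (S.q 0) → Fin (S.k 0) → ComplexSignal S.qs)
    (Y : Axis (S.q 0) → S.Rest → ComplexSignal S.qs) (i : Fin (m + 1)) (t : Axis (S.q 0)) :
    S.rhs (S.realState X Y) i t = ofComplexVec S.qs _ fun a =>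
      ∑ b : S.Rest, (S.A i b.1.succ a b.2 : ℂ) • Y t b +
        ∑ b, (S.A i 0 a b : ℂ) • X t b := by
  have h0 : matSignal (S.A i 0) (S.realState X Y 0 t) =
      ofComplexVec S.qs _ fun a => ∑ b, (S.A i 0 a b : ℂ) • X t b :=
    matSignal_ofComplexVec _ _
  have h1 : ∀ j : Fin m, matSignal (S.A i j.succ) (S.realState X Y j.succ t) =
      ofComplexVec S.qs _ fun a => ∑ b, (S.A i j.succ a b : ℂ) • Y t ⟨j, b⟩ := fun j =>
    matSignal_ofComplexVec _ _
  rw [rhs, Fin.sum_univ_succ, h0, Finset.sum_congr rfl fun j _ => h1 j, ← map_sum, ← map_add,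
    add_comm]
  congr 1
  ext1 a
  rw [Pi.add_apply, Finset.sum_apply, Fintype.sum_sigma]

variable {S}

theorem IsTrajectory.toComplex_space {x : S.StateSignal} (hx : S.IsTrajectory x)
    {t : Axis (S.q 0)} (ht : 0 ≤ t) (b : S.Rest) :
    AdvancesTo (S.qs b.1) Set.univ
      (fun h => shiftOp b.1 h (toComplex S.qs _ b.2 (x b.1.succ t))) 0
      (toComplex S.qs _ b.2 (S.rhs x b.1.succ t)) := by
  have h1 : AdvancesTo (S.qs b.1) Set.univ
      (fun h => toComplex S.qs _ b.2 (translate b.1 (x b.1.succ t) h)) 0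
      (toComplex S.qs _ b.2 (S.rhs x b.1.succ t)) := (hx.space t ht b.1).map _
  simpa only [toComplex_translate] using h1

variable {U : Fin m → ComplexSignal S.qs →L[ℂ] ComplexSignal S.qs}
  {G : (Fin (S.k 0) → ComplexSignal S.qs) →L[ℂ] (S.Rest → ComplexSignal S.qs)}
  {N : (Fin (S.k 0) → ComplexSignal S.qs) →L[ℂ] (Fin (S.k 0) → ComplexSignal S.qs)}

/-- The first state subvector of a trajectory solves an equation in the time alone. -/
theorem IsTrajectory.evolves {x : S.StateSignal} (hx : S.IsTrajectory x)
    (hU : ∀ i x y, AdvancesTo (S.qs i) Set.univ (fun s => shiftOp i s x) 0 y ↔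
      denOp (S.qs i) (U i) x = numOp (S.qs i) (U i) y)
    (hG : ∀ X Y, (∀ a : S.Rest, denOp (S.qs a.1) (U a.1) (Y a) = numOp (S.qs a.1) (U a.1)
      (∑ b, S.AM a b • Y b + ∑ b, S.BM a b • X b)) ↔ Y = G X)
    (hN : ∀ X a, N X a = ∑ b, S.DM a b • X b + ∑ b, S.CM a b • G X b) :
    Evolves (S.q 0) N fun t => toComplexVec S.qs (S.k 0) (x 0 t) := by
  intro t ht
  set X := toComplexVec S.qs (S.k 0) (x 0 t) with hX
  let Y : S.Rest → ComplexSignal S.qs := fun b => toComplex S.qs _ b.2 (x b.1.succ t)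
  have hY : Y = G X := (hG X Y).1 fun a => by
    have h1 := (hU a.1 _ _).1 (hx.toComplex_space ht a)
    rw [toComplex_rhs] at h1
    exact h1
  have h2 := (hx.time t ht).map (toComplexVec S.qs (S.k 0))
  have h3 : toComplexVec S.qs (S.k 0) (S.rhs x 0 t) = N X := by
    ext1 a
    rw [hN, ← hY]
    exact (toComplex_rhs S x 0 t a).trans (add_comm _ _)
  rwa [h3] at h2

/-- Complex solutions of the equation in the time give real trajectories. -/
theorem isTrajectory_realState {X : Axis (S.q 0) → Fin (S.k 0) → ComplexSignal S.qs}
    (hX : Evolves (S.q 0) N X)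
    (hU : ∀ i x y, AdvancesTo (S.qs i) Set.univ (fun s => shiftOp i s x) 0 y ↔
      denOp (S.qs i) (U i) x = numOp (S.qs i) (U i) y)
    (hG : ∀ X Y, (∀ a : S.Rest, denOp (S.qs a.1) (U a.1) (Y a) = numOp (S.qs a.1) (U a.1)
      (∑ b, S.AM a b • Y b + ∑ b, S.BM a b • X b)) ↔ Y = G X)
    (hN : ∀ X a, N X a = ∑ b, S.DM a b • X b + ∑ b, S.CM a b • G X b) :
    S.IsTrajectory (S.realState X fun t => G (X t)) where
  time t ht := by
    rw [rhs_realState]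
    have h1 := (hX t ht).map (ofComplexVec S.qs (S.k 0))
    have h2 : N (X t) = fun a => ∑ b : S.Rest, (S.A 0 b.1.succ a b.2 : ℂ) • G (X t) b +
        ∑ b, (S.A 0 0 a b : ℂ) • X t b := by
      ext1 a
      rw [hN, add_comm]
      rfl
    rwa [h2] at h1
  space t ht i := by
    rw [rhs_realState]
    have h1 : ∀ a : Fin (S.k i.succ), AdvancesTo (S.qs i) Set.univ
        (fun s => shiftOp i s (G (X t) ⟨i, a⟩)) 0
        (∑ b : S.Rest, (S.A i.succ b.1.succ a b.2 : ℂ) • G (X t) b +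
          ∑ b, (S.A i.succ 0 a b : ℂ) • X t b) := fun a =>
      (hU i _ _).2 ((hG (X t) (G (X t))).2 rfl ⟨i, a⟩)
    have h2 := AdvancesTo.sum (c := Finset.univ) fun a _ =>
      (h1 a).map (ofComplex S.qs (S.k i.succ) a)
    rw [← ofComplexVec_apply (q := S.qs) (d := S.k i.succ)] at h2
    refine Eq.mp ?_ h2
    congr 1
    funext s
    exact (translate_ofComplexVec (q := S.qs) i s fun a => G (X t) ⟨i, a⟩).symm

/-! ### Stability -/

/-- Decay of the evolution under `N` is transported through the maps between real signals and their
complex coordinates, at the cost of the factors `‖ρ‖` and `‖c‖`. -/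
theorem timeRelevantStable_of_inRegion
    (hU : ∀ i x y, AdvancesTo (S.qs i) Set.univ (fun s => shiftOp i s x) 0 y ↔
      denOp (S.qs i) (U i) x = numOp (S.qs i) (U i) y)
    (hG : ∀ X Y, (∀ a : S.Rest, denOp (S.qs a.1) (U a.1) (Y a) = numOp (S.qs a.1) (U a.1)
      (∑ b, S.AM a b • Y b + ∑ b, S.BM a b • X b)) ↔ Y = G X)
    (hN : ∀ X a, N X a = ∑ b, S.DM a b • X b + ∑ b, S.CM a b • G X b)
    (hdecay : Tendsto (fun n : ℕ => ‖stepOp (S.q 0) N ^ n‖) atTop (𝓝 0)) :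
    S.TimeRelevantStable := by
  obtain ⟨⟨C, hC0, hC⟩, hT⟩ := exists_decay (S.q 0) N hdecay
  set c := toComplexVec S.qs (S.k 0) with hc
  set ρ := ofComplexVec S.qs (S.k 0) with hρ
  have key : ∀ x, S.IsTrajectory x → ∀ (t : Axis (S.q 0)) (r : ℝ), 0 ≤ r →
      ‖c (x 0 t)‖ ≤ r * ‖c (x 0 0)‖ → ‖x 0 t‖ ≤ ‖ρ‖ * (r * (‖c‖ * ‖x 0 0‖)) := by
    intro x _ t r hr h
    calc ‖x 0 t‖ = ‖ρ (c (x 0 t))‖ := by rw [hρ, hc, ofComplexVec_toComplexVec]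
      _ ≤ ‖ρ‖ * ‖c (x 0 t)‖ := ρ.le_opNorm _
      _ ≤ ‖ρ‖ * (r * ‖c (x 0 0)‖) := by gcongr
      _ ≤ ‖ρ‖ * (r * (‖c‖ * ‖x 0 0‖)) := by
        gcongr
        exact c.le_opNorm _
  constructor
  · intro ε hε
    refine ⟨ε / (‖ρ‖ * (C * ‖c‖) + 1), by positivity, fun x hx hx0 t ht => ?_⟩
    refine (key x hx t C hC0.le (hC _ (hx.evolves hU hG hN) t ht)).trans ?_
    rw [le_div_iff₀ (by positivity)] at hx0
    nlinarith [norm_nonneg (x 0 0)]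
  · refine ⟨1, one_pos, fun ε hε => ?_⟩
    obtain ⟨T, hT0, hT⟩ := hT (ε / (‖ρ‖ * ‖c‖ + 1)) (by positivity)
    refine ⟨T, hT0, fun x hx hx0 t ht => ?_⟩
    refine (key x hx t _ (by positivity) (hT _ (hx.evolves hU hG hN) t ht)).trans ?_
    calc ‖ρ‖ * (ε / (‖ρ‖ * ‖c‖ + 1) * (‖c‖ * ‖x 0 0‖))
        ≤ ‖ρ‖ * (ε / (‖ρ‖ * ‖c‖ + 1) * (‖c‖ * 1)) := by gcongr
      _ = ε * (‖ρ‖ * ‖c‖ / (‖ρ‖ * ‖c‖ + 1)) := by ring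
      _ ≤ ε * 1 := by
        gcongr
        rw [div_le_one (by positivity)]
        linarith
      _ = ε := mul_one ε

/-- At the time `T` supplied by attractivity the flow shrinks a whole ball of complex data. On
approximate eigenvectors it is nearly multiplication by `scalarFlow z T`, so this number has modulus
below 1. -/
theorem TimeRelevantStable.inRegion (hst : S.TimeRelevantStable)
    (hU : ∀ i x y, AdvancesTo (S.qs i) Set.univ (fun s => shiftOp i s x) 0 y ↔
      denOp (S.qs i) (U i) x = numOp (S.qs i) (U i) y)
    (hG : ∀ X Y, (∀ a : S.Rest, denOp (S.qs a.1) (U a.1) (Y a) = numOp (S.qs a.1) (U a.1)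
      (∑ b, S.AM a b • Y b + ∑ b, S.BM a b • X b)) ↔ Y = G X)
    (hN : ∀ X a, N X a = ∑ b, S.DM a b • X b + ∑ b, S.CM a b • G X b)
    {w : ℕ → ComplexSignal S.qs} (hw : ∀ n, ‖w n‖ = 1) {z : ℂ} {v : Fin (S.k 0) → ℂ} (hv : v ≠ 0)
    (hNw : Tendsto (fun n => N (fun a => v a • w n) - z • fun a => v a • w n) atTop (𝓝 0)) :
    InRegion (S.q 0) z := by
  obtain ⟨Φ, hΦ0, hΦ, hΦz⟩ := exists_evolves (S.q 0) N
  obtain ⟨η, hη, hatt⟩ := hst.attractive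
  set c := toComplexVec S.qs (S.k 0) with hc
  set ρ := ofComplexVec S.qs (S.k 0) with hρ
  have hv0 : 0 < ‖v‖ := norm_pos_iff.2 hv
  have hfn : ∀ n, ‖fun a => v a • w n‖ = ‖v‖ := fun n => by
    refine le_antisymm ((pi_norm_le_iff_of_nonneg (norm_nonneg v)).2 fun a => ?_)
      ((pi_norm_le_iff_of_nonneg (norm_nonneg _)).2 fun a => ?_)
    · rw [norm_smul, hw, mul_one]
      exact norm_le_pi_norm v a
    · have := norm_le_pi_norm (fun a => v a • w n) a
      rwa [norm_smul, hw, mul_one] at this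
  -- `r` scales the data so that their real parts start in the ball of radius `η`; `ε` is small
  -- enough that the two real pieces add up to less than the initial norm `r * ‖v‖`.
  set r := η / ((‖ρ‖ + 1) * ‖v‖) with hr
  have hr0 : 0 < r := by positivity
  set ε := r * ‖v‖ / (4 * (‖c‖ + 1)) with hε
  obtain ⟨T, hT0, hT⟩ := hatt ε (by positivity)
  have hreal : ∀ f, ‖f‖ ≤ r * ‖v‖ → ‖ρ (Φ T f)‖ ≤ ε := by
    intro f hf
    refine hT _ (isTrajectory_realState (hΦ f) hU hG hN) ?_ T le_rfl
    change ‖ρ (Φ 0 f)‖ ≤ η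
    rw [hΦ0]
    refine (ρ.le_opNorm _).trans ?_
    calc ‖ρ‖ * ‖f‖ ≤ (‖ρ‖ + 1) * (r * ‖v‖) := by gcongr; linarith
      _ = η := by
        rw [hr]
        field_simp
  have hcomplex : ∀ f, ‖f‖ ≤ r * ‖v‖ → ‖Φ T f‖ ≤ ‖c‖ * ε + ‖c‖ * ε := by
    intro f hf
    have h1 : Φ T f = c (ρ (Φ T f)) + Complex.I • c (ρ (Φ T (-Complex.I • f))) := by
      rw [map_smul (Φ T) (-Complex.I) f]
      exact toComplexVec_ofComplexVec (Φ T f)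
    refine (congrArg norm h1).trans_le ?_
    refine (norm_add_le _ _).trans (add_le_add ?_ ?_)
    · refine (c.le_opNorm _).trans ?_
      gcongr
      exact hreal f hf
    · rw [norm_smul, Complex.norm_I, one_mul]
      refine (c.le_opNorm _).trans ?_
      gcongr
      refine hreal _ ?_
      -- The imaginary part is the real part of the solution started at `-i f`, whose norm is the
      -- same.
      rwa [norm_smul, norm_neg, Complex.norm_I, one_mul]
  obtain ⟨K, hK⟩ := hΦz T z
  refine inRegion_of_norm_scalarFlow_lt_one hT0 ?_
  have hle : ∀ n, ‖scalarFlow (S.q 0) z T‖ * (r * ‖v‖) ≤ ‖c‖ * ε + ‖c‖ * ε +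
      ‖K‖ * (r * ‖N (fun a => v a • w n) - z • fun a => v a • w n‖) := by
    intro n
    set f : Fin (S.k 0) → ComplexSignal S.qs := (r : ℂ) • fun a => v a • w n with hf
    have hfnorm : ‖f‖ = r * ‖v‖ := by
      rw [hf, norm_smul, hfn, Complex.norm_real, Real.norm_of_nonneg hr0.le]
    have h1 : ‖N f - z • f‖ = r * ‖N (fun a => v a • w n) - z • fun a => v a • w n‖ := by
      rw [hf, map_smul, smul_comm z, ← smul_sub, norm_smul, Complex.norm_real,
        Real.norm_of_nonneg hr0.le]
    rw [← hfnorm, ← norm_smul, ← h1]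
    have h2 : scalarFlow (S.q 0) z T • f = Φ T f - K (N f - z • f) := by
      rw [← hK]
      abel
    rw [h2]
    exact (norm_sub_le _ _).trans (add_le_add (hcomplex f hfnorm.le) (K.le_opNorm _))
  have hlim : Tendsto (fun n => ‖c‖ * ε + ‖c‖ * ε +
      ‖K‖ * (r * ‖N (fun a => v a • w n) - z • fun a => v a • w n‖)) atTop
      (𝓝 (‖c‖ * ε + ‖c‖ * ε)) := by
    simpa using ((hNw.norm.const_mul r).const_mul ‖K‖).const_add (‖c‖ * ε + ‖c‖ * ε)
  have hfin := ge_of_tendsto' hlim hle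
  have hlt : ‖c‖ * ε + ‖c‖ * ε < r * ‖v‖ := by
    have h3 : 4 * (‖c‖ + 1) * ε = r * ‖v‖ := by
      rw [hε]
      field_simp
    have h4 : 0 < ε := by positivity
    nlinarith [norm_nonneg c]
  by_contra h
  have h5 : 1 * (r * ‖v‖) ≤ ‖scalarFlow (S.q 0) z T‖ * (r * ‖v‖) := by
    have := not_lt.1 h
    gcongr
  linarith

end Model

end Signals

end Roesser

end

/-! ### The equivalence -/

theorem mainTheorem5 {m : ℕ} (S : Roesser.Model m) (hS : S.WellPosed) :
    S.TimeRelevantStable ↔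
      ∃ P : (Fin m → OnePoint ℂ) → Matrix (Fin (S.k 0)) (Fin (S.k 0)) ℂ,
        ∀ δ ∈ S.boundary, S.SolvesStein δ (P δ) := by
  open Roesser Filter Topology in
  choose U U' hU hU' hUU' hU'U hadv hcomm happ using fun i : Fin m =>
    exists_axisOperator (S.qs i) (fun s => shiftOp (q := S.qs) i s) (shiftOp_zero i)
      (shiftOp_add i) (norm_shiftOp i) (continuous_shiftOp i)
  -- `U i` inherits the commutation with each translation along axis `j`, and `U j` then commutes
  -- with `U i` for the same reason.
  have hUcomm : ∀ i j, U i * U j = U j * U i := fun i j =>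
    hcomm j (U i) fun s => (hcomm i _ fun s' => shiftOp_commute j i s s').symm
  obtain ⟨G, N, hG, hN, hdecay, happrox⟩ := hS.exists_operator U U' hU hU' hUU' hU'U hUcomm
  constructor
  · intro hst
    have hsol : ∀ δ ∈ S.boundary, ∃ P, S.SolvesStein δ P := fun δ hδ => by
      refine exists_steinForm (S.q 0) (S.M δ) fun z v hv hzv => ?_
      obtain ⟨u, hu, hw⟩ := happrox δ hδ
      choose χ hχ hχw using fun i => happ i (u i) (hu i)
      -- The `n`-th wave combines the `n`-th characters of all axes, on a box of side `n + 1`, so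
      -- one sequence serves every `U i` at once.
      choose w hw1 hws using fun n : ℕ =>
        exists_almost_eigenvector (fun i => hχ i n) (Nat.succ_pos n)
      have hε : Tendsto (fun n : ℕ => 2 / Real.sqrt ((n + 1 : ℕ) : ℝ)) atTop (𝓝 0) :=
        ((Real.tendsto_sqrt_atTop.comp tendsto_natCast_atTop_atTop).const_div_atTop 2).comp
          (tendsto_add_atTop_nat 1)
      exact hst.inRegion hadv hG hN hw1 hv (hw w (fun i => hχw i w _ (fun n => (hw1 n).le) hε
        fun n s => hws n i s) z v hzv)
    -- The choice is made pointwise; no regularity in `δ` is asked for.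
    choose! P hP using hsol
    exact ⟨P, hP⟩
  · rintro ⟨P, hP⟩
    exact Model.timeRelevantStable_of_inRegion hadv hG hN (hdecay fun δ hδ z v hv hzv =>
      inRegion_of_steinForm (hP δ hδ).1 (hP δ hδ).2 hv hzv)
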